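/- **Setting.** Let $(M,g)$ be a smooth connected oriented $(3+1)$-dimensional space-time of signature $(-,+,+,+)$ with volume form $\epsilon$, let $\Lambda\in\mathbb R$, and suppose that $R_{\mu\nu}=\Lambda g_{\mu\nu}$. If $\Lambda\neq 0$, suppose in addition that the conformal Weyl tensor $C_{\mu\nu\sigma\rho}$ of $g$ does not vanish identically. Let $$\mathcal C_{\mu\nu\sigma\rho}=C_{\mu\nu\sigma\rho}+\tfrac i2\,\epsilon_{\sigma\rho}{}^{\gamma\delta}C_{\mu\nu\gamma\delta},\qquad \mathcal C^2=\mathcal C^{\mu\nu\sigma\rho}\mathcal C_{\mu\nu\sigma\rho},\qquad \mathcal I_{\mu\nu\sigma\rho}=\tfrac14\big(g_{\mu\sigma}g_{\nu\rho}-g_{\mu\rho}g_{\nu\sigma}+i\epsilon_{\mu\nu\sigma\rho}\big).$$ Let $\mathcal F_{\mu\nu}$ be a smooth complex two-form on $M$ that is self-dual, $\mathcal F_{\mu\nu}=\frac i2\epsilon_{\mu\nu}{}^{\alpha\beta}\mathcal F_{\alpha\beta}$, put $\mathcal F^2=\mathcal F_{\mu\nu}\mathcal F^{\mu\nu}$,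 and let $Q:M\to\mathbb C$ be a function such that $$\mathcal S_{\alpha\beta\mu\nu}:=\mathcal C_{\alpha\beta\mu\nu}-Q\Big(\mathcal F_{\alpha\beta}\mathcal F_{\mu\nu}-\tfrac13\mathcal F^2\,\mathcal I_{\alpha\beta\mu\nu}\Big)=0\quad\text{on } M.$$ **Roots and signs.** In (ii) and (iii) below, a choice of roots is a continuous function $\rho:M\to\mathbb C$ with $\rho^6=\mathcal C^2$, and $\sqrt{\mathcal C^2}:=\rho^3$, $(\mathcal C^2)^{-1/3}:=\rho^{-2}$, $(\mathcal C^2)^{5/6}:=\rho^5$. The sign $\pm$ is a constant, the same in all formulas of the statement concerned, and it is the one for which $Q\mathcal F^2=\pm\sqrt{3/2}\,\sqrt{\mathcal C^2}$ at some point of $M$. (Since $\mathcal S=0$ implies $Q^2\mathcal F^4=\frac32\mathcal C^2$, in (ii) and (iii) this equation then holds at every point.) **Lemma.** The following statements are equivalent: (i) $Q$ is differentiable and $$\mathcal F^2\,\partial_\kappa Q+\frac14\,\frac{Q\mathcal F^2+20\Lambda}{Q\mathcal F^2+2\Lambda}\,Q\,\partial_\kappa\mathcal F^2=0,$$ and $\mathcal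 F^2\neq0$, $Q\mathcal F^2-4\Lambda\neq0$, $Q\mathcal F^2+2\Lambda\neq0$ everywhere on $M$. (ii) There are a choice of roots, the corresponding sign $\pm$ and a constant $\widehat\varkappa\in\mathbb C\setminus\{0\}$ such that $$\mathcal F^2=\widehat\varkappa\Big(\frac32\Big)^{2/3}(\mathcal C^2)^{-1/3}\Big(\pm\sqrt{\mathcal C^2}-\sqrt{\tfrac{32}{3}}\,\Lambda\Big)^2,$$ and everywhere on $M$ $$\mathcal C^2\neq0,\qquad \pm\sqrt{\mathcal C^2}-\sqrt{\tfrac{32}{3}}\,\Lambda\neq0,\qquad \pm\sqrt{\mathcal C^2}+\sqrt{\tfrac83}\,\Lambda\neq0.\tag{$*$}$$ (iii) There are a choice of roots, the corresponding sign $\pm$ and a constant $\varkappa\in\mathbb C\setminus\{0\}$ such that $$Q=Q_{\mathcal C}:=\varkappa\,(\mathcal C^2)^{5/6}\Big(\pm\sqrt{\mathcal C^2}-\sqrt{\tfrac{32}{3}}\,\Lambda\Big)^{-2},$$ and the inequalities $(*)$ hold everywhere on $M$. -/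

import Mathlib

open scoped Manifold ContDiff

noncomputable section

namespace MarsSimon

/-- The model space of a four-dimensional manifold. -/
abbrev E4 : Type := EuclideanSpace ℝ (Fin 4)

/-! ### Lorentzian metrics, volume forms and complex two-forms -/

/-- The Minkowski matrix `diag(-1, 1, 1, 1)`. -/
def eta (i j : Fin 4) : ℝ := if i = j then (if i = 0 then -1 else 1) else 0

variable (M : Type*) [TopologicalSpace M] [ChartedSpace E4 M] [IsManifold 𝓘(ℝ, E4) ∞ M]

/-- A smooth Lorentzian metric of signature `(-,+,+,+)`. -/
structure LorentzMetric where
  /-- the scalar product of the tangent space at a point -/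
  val : ∀ x : M, TangentSpace 𝓘(ℝ, E4) x →L[ℝ] TangentSpace 𝓘(ℝ, E4) x →L[ℝ] ℝ
  symm : ∀ (x : M) (v w : TangentSpace 𝓘(ℝ, E4) x), val x v w = val x w v
  lorentz : ∀ x : M, ∃ b : Module.Basis (Fin 4) ℝ (TangentSpace 𝓘(ℝ, E4) x),
    ∀ i j, val x (b i) (b j) = eta i j
  smooth : ContMDiff 𝓘(ℝ, E4) (𝓘(ℝ, E4).prod 𝓘(ℝ, E4 →L[ℝ] E4 →L[ℝ] ℝ)) ∞
    (fun x ↦ Bundle.TotalSpace.mk' (E4 →L[ℝ] E4 →L[ℝ] ℝ)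
      (E := fun x : M ↦ TangentSpace 𝓘(ℝ, E4) x →L[ℝ] TangentSpace 𝓘(ℝ, E4) x →L[ℝ] ℝ) x (val x))

/-- A smooth complex-valued two-form. -/
structure ComplexTwoForm where
  /-- the value of the form at a point -/
  val : ∀ x : M, TangentSpace 𝓘(ℝ, E4) x →L[ℝ] TangentSpace 𝓘(ℝ, E4) x →L[ℝ] ℂ
  antisymm : ∀ (x : M) (v w : TangentSpace 𝓘(ℝ, E4) x), val x v w = -val x w v
  smooth : ContMDiff 𝓘(ℝ, E4) (𝓘(ℝ, E4).prod 𝓘(ℝ, E4 →L[ℝ] E4 →L[ℝ] ℂ)) ∞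
    (fun x ↦ Bundle.TotalSpace.mk' (E4 →L[ℝ] E4 →L[ℝ] ℂ)
      (E := fun x : M ↦ TangentSpace 𝓘(ℝ, E4) x →L[ℝ] TangentSpace 𝓘(ℝ, E4) x →L[ℝ] ℂ) x (val x))

variable {M}

/-- The coordinate vector `∂ᵢ` of the chart `e`, at the point with coordinates `y`. -/
def coordVec (e : OpenPartialHomeomorph M E4) (y : E4) (i : Fin 4) :
    TangentSpace 𝓘(ℝ, E4) (e.symm y) :=
  mfderiv 𝓘(ℝ, E4) 𝓘(ℝ, E4) e.symm y (EuclideanSpace.single i (1 : ℝ) : E4)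

/-- A volume form of an oriented Lorentzian four-manifold: a smooth real four-form which takes
the values `±1` on the orthonormal bases. The smoothness is that of its component
`ε(∂₀, ∂₁, ∂₂, ∂₃)` in every chart. -/
structure VolumeForm (g : LorentzMetric M) where
  /-- the value of the form at a point -/
  val : ∀ x : M, AlternatingMap ℝ (TangentSpace 𝓘(ℝ, E4) x) ℝ (Fin 4)
  unit : ∀ (x : M) (b : Module.Basis (Fin 4) ℝ (TangentSpace 𝓘(ℝ, E4) x)),
    (∀ i j, g.val x (b i) (b j) = eta i j) → |val x b| = 1
  smooth : ∀ e ∈ atlas E4 M,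
    ContDiffOn ℝ ∞ (fun y ↦ val (e.symm y) (coordVec e y)) e.target

/-! ### Components and curvature in a chart

In what follows `e` is a chart and `y : E4` is a point of its target. -/

/-- The partial derivative `∂ᵢ f`. -/
def pd (i : Fin 4) (f : E4 → ℝ) (y : E4) : ℝ := fderiv ℝ f y (EuclideanSpace.single i (1 : ℝ))

section Components

variable (g : LorentzMetric M) (e : OpenPartialHomeomorph M E4)

/-- `g_{ij}` -/
def metric (y : E4) (i j : Fin 4) : ℝ := g.val (e.symm y) (coordVec e y i) (coordVec e y j)

/-- `g^{ij}`, the inverse matrix of `g_{ij}` -/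
def metricInv (y : E4) (i j : Fin 4) : ℝ :=
  ((Matrix.of fun a b ↦ metric g e y a b)⁻¹ : Matrix (Fin 4) (Fin 4) ℝ) i j

/-- The Christoffel symbol `Γ^k_{ij}` of the Levi-Civita connection. -/
def christoffel (k i j : Fin 4) (y : E4) : ℝ :=
  (1 / 2) * ∑ l, metricInv g e y k l *
    (pd i (fun z ↦ metric g e z j l) y + pd j (fun z ↦ metric g e z i l) y
      - pd l (fun z ↦ metric g e z i j) y)

/-- The Riemann tensor `R^r_{smn}`
`= ∂_m Γ^r_{ns} - ∂_n Γ^r_{ms} + Γ^r_{ml} Γ^l_{ns} - Γ^r_{nl} Γ^l_{ms}`. -/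
def riemannUp (y : E4) (r s m n : Fin 4) : ℝ :=
  pd m (christoffel g e r n s) y - pd n (christoffel g e r m s) y
    + ∑ l, (christoffel g e r m l y * christoffel g e l n s y
      - christoffel g e r n l y * christoffel g e l m s y)

/-- `R_{rsmn}` -/
def riemann (y : E4) (r s m n : Fin 4) : ℝ := ∑ l, metric g e y r l * riemannUp g e y l s m n

/-- The Ricci tensor `R_{sn} = R^r_{srn}`. -/
def ricci (y : E4) (s n : Fin 4) : ℝ := ∑ r, riemannUp g e y r s r n

/-- The scalar curvature. -/
def scalarCurv (y : E4) : ℝ := ∑ s, ∑ n, metricInv g e y s n * ricci g e y s n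

/-- The conformal Weyl tensor `C_{rsmn}` in dimension four. -/
def weyl (y : E4) (r s m n : Fin 4) : ℝ :=
  riemann g e y r s m n
    - (1 / 2) * (metric g e y r m * ricci g e y s n - metric g e y r n * ricci g e y s m
      - metric g e y s m * ricci g e y r n + metric g e y s n * ricci g e y r m)
    + (scalarCurv g e y / 6) *
      (metric g e y r m * metric g e y s n - metric g e y r n * metric g e y s m)

variable {g} (ε : VolumeForm g)

/-- `ε_{abcd}` -/
def vol (y : E4) (a b c d : Fin 4) : ℝ :=
  ε.val (e.symm y) ![coordVec e y a, coordVec e y b, coordVec e y c, coordVec e y d]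

/-- `ε_{ab}^{cd}` -/
def volUp (y : E4) (a b c d : Fin 4) : ℝ :=
  ∑ m, ∑ n, vol e ε y a b m n * metricInv g e y m c * metricInv g e y n d

/-- The Hodge dual `W*_{ab} = ½ ε_{ab}^{cd} W_{cd}` of the two-form with components `W`. -/
def hodge (y : E4) (W : Fin 4 → Fin 4 → ℂ) (a b : Fin 4) : ℂ :=
  (1 / 2) * ∑ c, ∑ d, (volUp e ε y a b c d : ℂ) * W c d

/-- The self-dual Weyl tensor `𝒞 = C + i C*`, where `C*` is the (right) Hodge dual. -/
def sdWeyl (y : E4) (a b m n : Fin 4) : ℂ :=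
  (weyl g e y a b m n : ℂ)
    + Complex.I * hodge e ε y (fun c d ↦ (weyl g e y a b c d : ℂ)) m n

/-- `𝓘_{abcd} = ¼ (g_{ac} g_{bd} - g_{ad} g_{bc} + i ε_{abcd})` -/
def sdId (y : E4) (a b c d : Fin 4) : ℂ :=
  (1 / 4) * ((metric g e y a c * metric g e y b d - metric g e y a d * metric g e y b c : ℝ)
    + Complex.I * (vol e ε y a b c d : ℂ))

/-- `𝒞² = 𝒞^{abcd} 𝒞_{abcd}` at the point with coordinates `y` -/
def weylSqIn (y : E4) : ℂ :=
  ∑ a, ∑ b, ∑ c, ∑ d, ∑ a', ∑ b', ∑ c', ∑ d',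
    (metricInv g e y a a' * metricInv g e y b b' * metricInv g e y c c' * metricInv g e y d d' : ℝ)
      * sdWeyl e ε y a' b' c' d' * sdWeyl e ε y a b c d

variable (F : ComplexTwoForm M)

/-- `ℱ_{ab}` -/
def formComp (y : E4) (a b : Fin 4) : ℂ := F.val (e.symm y) (coordVec e y a) (coordVec e y b)

variable (g) in
/-- `ℱ² = ℱ^{ab} ℱ_{ab}` at the point with coordinates `y` -/
def formSqIn (y : E4) : ℂ :=
  ∑ a, ∑ b, ∑ a', ∑ b', (metricInv g e y a a' * metricInv g e y b b' : ℝ)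
    * formComp e F y a' b' * formComp e F y a b

/-- `𝒮_{abcd} = 𝒞_{abcd} - Q (ℱ_{ab} ℱ_{cd} - ⅓ ℱ² 𝓘_{abcd})` -/
def mst (Q : M → ℂ) (y : E4) (a b c d : Fin 4) : ℂ :=
  sdWeyl e ε y a b c d
    - Q (e.symm y) * (formComp e F y a b * formComp e F y c d
      - (1 / 3) * formSqIn g e F y * sdId e ε y a b c d)

end Components

/-! ### Tensor equations and scalars on the manifold

A tensor equation is the equation of the components in every chart of the atlas. A scalar is
computed at `x` in the preferred chart at `x`. -/

/-- Einstein's vacuum equations `R_{ij} = Λ g_{ij}` with cosmological constant `Λ`. -/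
def IsLambdaVacuum (g : LorentzMetric M) (Λ : ℝ) : Prop :=
  ∀ e ∈ atlas E4 M, ∀ y ∈ e.target, ∀ i j, ricci g e y i j = Λ * metric g e y i j

/-- The Weyl tensor vanishes identically. -/
def IsConformallyFlat (g : LorentzMetric M) : Prop :=
  ∀ e ∈ atlas E4 M, ∀ y ∈ e.target, ∀ a b c d, weyl g e y a b c d = 0

/-- `ℱ = i ℱ*` -/
def IsSelfDual {g : LorentzMetric M} (ε : VolumeForm g) (F : ComplexTwoForm M) : Prop :=
  ∀ e ∈ atlas E4 M, ∀ y ∈ e.target, ∀ a b,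
    formComp e F y a b = Complex.I * hodge e ε y (formComp e F y) a b

/-- `𝒮 = 0` -/
def MSTVanishes {g : LorentzMetric M} (ε : VolumeForm g) (F : ComplexTwoForm M) (Q : M → ℂ) :
    Prop :=
  ∀ e ∈ atlas E4 M, ∀ y ∈ e.target, ∀ a b c d, mst e ε F Q y a b c d = 0

/-- The scalar field `ℱ²`. -/
def formSq (g : LorentzMetric M) (F : ComplexTwoForm M) (x : M) : ℂ :=
  formSqIn g (chartAt E4 x) F (chartAt E4 x x)

/-- The scalar field `𝒞²`. -/
def weylSq {g : LorentzMetric M} (ε : VolumeForm g) (x : M) : ℂ :=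
  weylSqIn (chartAt E4 x) ε (chartAt E4 x x)

/-! ### The conditions -/

/-- `Q` is differentiable and
`ℱ² ∂_κ Q + ¼ (Qℱ² + 20Λ) / (Qℱ² + 2Λ) Q ∂_κ ℱ² = 0`. -/
def SatisfiesPDE (g : LorentzMetric M) (Λ : ℝ) (F : ComplexTwoForm M) (Q : M → ℂ) : Prop :=
  MDifferentiable 𝓘(ℝ, E4) 𝓘(ℝ, ℂ) Q ∧
    ∀ (x : M) (v : TangentSpace 𝓘(ℝ, E4) x),
      formSq g F x * (show ℂ from mfderiv 𝓘(ℝ, E4) 𝓘(ℝ, ℂ) Q x v)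
        + (1 / 4) * ((Q x * formSq g F x + 20 * Λ) / (Q x * formSq g F x + 2 * Λ)) * Q x
          * (show ℂ from mfderiv 𝓘(ℝ, E4) 𝓘(ℝ, ℂ) (formSq g F) x v) = 0

/-- `ℱ² ≠ 0`, `Qℱ² - 4Λ ≠ 0` and `Qℱ² + 2Λ ≠ 0` everywhere. -/
def NonvanishingFQ (g : LorentzMetric M) (Λ : ℝ) (F : ComplexTwoForm M) (Q : M → ℂ) : Prop :=
  ∀ x : M, formSq g F x ≠ 0 ∧ Q x * formSq g F x - 4 * Λ ≠ 0 ∧ Q x * formSq g F x + 2 * Λ ≠ 0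

/-- The choice of roots and of the sign `±` (here `σ`). The function `ρ` is a continuous sixth
root of `𝒞²`; it gives the roots `√𝒞² = ρ³`, `(𝒞²)^{-1/3} = ρ⁻²`, `(𝒞²)^{5/6} = ρ⁵`. The sign is
the one for which `Q` is `Q_ℱ = ± √(3/2) ℱ⁻² √𝒞²`. It is prescribed at one point: as `𝒮 = 0` gives
`Q² ℱ⁴ = (3/2) 𝒞²`, the equation `Q = Q_ℱ` then extends to the rest of a connected manifold on
which `𝒞²` has no zero and `Q ℱ²` is continuous. -/
def IsRootChoice {g : LorentzMetric M} (ε : VolumeForm g) (F : ComplexTwoForm M) (Q : M → ℂ)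
    (ρ : M → ℂ) (σ : ℂ) : Prop :=
  Continuous ρ ∧ (∀ x, ρ x ^ 6 = weylSq ε x) ∧ (σ = 1 ∨ σ = -1) ∧
    ∃ x₀ : M, Q x₀ * formSq g F x₀ = σ * (√(3 / 2) : ℝ) * ρ x₀ ^ 3

/-- `𝒞² ≠ 0`, `±√𝒞² - √(32/3) Λ ≠ 0` and `±√𝒞² + √(8/3) Λ ≠ 0` everywhere. -/
def NonvanishingC {g : LorentzMetric M} (ε : VolumeForm g) (Λ : ℝ) (ρ : M → ℂ) (σ : ℂ) : Prop :=
  ∀ x : M, weylSq ε x ≠ 0 ∧ σ * ρ x ^ 3 - (√(32 / 3) : ℝ) * Λ ≠ 0 ∧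
    σ * ρ x ^ 3 + (√(8 / 3) : ℝ) * Λ ≠ 0

/-- `ℱ² = ϰ̂ (3/2)^{2/3} (𝒞²)^{-1/3} (±√𝒞² - √(32/3) Λ)²` for a constant `ϰ̂ ≠ 0`. -/
def RelatesCF (g : LorentzMetric M) (Λ : ℝ) (F : ComplexTwoForm M) (ρ : M → ℂ) (σ : ℂ) : Prop :=
  ∃ k : ℂ, k ≠ 0 ∧ ∀ x : M, formSq g F x =
    k * ((3 / 2 : ℝ) ^ (2 / 3 : ℝ) : ℝ) * (ρ x ^ 2)⁻¹ * (σ * ρ x ^ 3 - (√(32 / 3) : ℝ) * Λ) ^ 2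

/-- `Q = Q_𝒞`, i.e. `Q = ϰ (𝒞²)^{5/6} (±√𝒞² - √(32/3) Λ)⁻²` for a constant `ϰ ≠ 0`. -/
def IsQC (Λ : ℝ) (Q : M → ℂ) (ρ : M → ℂ) (σ : ℂ) : Prop :=
  ∃ k : ℂ, k ≠ 0 ∧ ∀ x : M, Q x =
    k * ρ x ^ 5 * ((σ * ρ x ^ 3 - (√(32 / 3) : ℝ) * Λ) ^ 2)⁻¹

end MarsSimon

end

/-!
Write `u = ℱ²` and `P = Q u`.

Pointwise, `𝒮 = 0` says `𝒞 = Q (ℱ ⊗ ℱ - ⅓ u 𝓘)`. Acting on two-forms, `𝓘` is the projection onto the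
self-dual ones, so that `𝓘 ℱ = ℱ` and `tr 𝓘 = tr 𝓘² = 3`; squaring the relation gives
`𝒞² = ⅔ P²` (`selfDual_contraction`, `weylSq_eq`). In particular `𝒞²` does not depend on the chart,
as `u` does not. Where `𝒞² ≠ 0`, some component of `ℱ ⊗ ℱ - ⅓ u 𝓘` is nonzero, and there `Q` is a
quotient of smooth component functions; hence `Q` is differentiable there
(`mdifferentiableAt_of_weylSq_ne_zero`).

The differential equation integrates in closed form: away from the zeros of the denominators,
`d (u³ P² / (P - 4Λ)⁶)` is a multiple of its left-hand side, with a factor that has no zero where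
`u`, `P` and `P + 2Λ` have none (`hasDerivAt_firstIntegral`). So (i) makes this first integral
a constant `K` of the connected manifold. If `K` were zero, `Q` would vanish identically and the
space-time would be conformally flat; this is excluded by assumption for `Λ ≠ 0`, and by
`P - 4Λ ≠ 0` for `Λ = 0`. For `K ≠ 0` the function `P` is, up to a constant, the cube of
`P u / (P - 4Λ)²`, which supplies the continuous sixth root of `𝒞²` and the formula for `u` in (ii)
(`exists_root_of_pde`). Conversely, once `𝒞²` has no zero, `P = ±√(3/2) √𝒞²` spreads from one
point to all of `M` by continuity (`mul_formSq_eq_root`). This turns (ii) and (iii) into each other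
(`relatesCF_iff_isQC`), and shows under (ii) that the first integral is constant, which is (i)
(`pde_of_relatesCF`).
-/

namespace MarsSimon

/-! ### Contractions of alternating four-forms -/

theorem sum_pi_fin_four {α β : Type*} [Fintype α] [AddCommMonoid β] (φ : (Fin 4 → α) → β) :
    ∑ f, φ f = ∑ a, ∑ b, ∑ c, ∑ d, φ ![a, b, c, d] := by
  have step : ∀ (n : ℕ) (ψ : (Fin (n + 1) → α) → β),
      ∑ f, ψ f = ∑ a, ∑ f : Fin n → α, ψ (Matrix.vecCons a f) := fun n ψ ↦ by
    rw [← (Fin.consEquiv fun _ ↦ α).sum_comp, Fintype.sum_prod_type]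
    rfl
  simp only [step, Finset.univ_unique, Finset.sum_singleton]
  refine Finset.sum_congr rfl fun a _ ↦ Finset.sum_congr rfl fun b _ ↦
    Finset.sum_congr rfl fun c _ ↦ Finset.sum_congr rfl fun d _ ↦ ?_
  congr!

/-- Only the bijective `f` contribute, and the two signs cancel for each of the `24` of them. -/
theorem sum_alternating_mul {V : Type*} [AddCommGroup V] [Module ℝ V]
    (ν : V [⋀^Fin 4]→ₗ[ℝ] ℝ) (v w : Fin 4 → V) :
    ∑ f : Fin 4 → Fin 4, ν (v ∘ f) * ν (w ∘ f) = 24 * ν v * ν w := by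
  have h : ∑ τ : Equiv.Perm (Fin 4), ν (v ∘ τ) * ν (w ∘ τ)
      = ∑ f : Fin 4 → Fin 4, ν (v ∘ f) * ν (w ∘ f) := by
    refine Finset.sum_of_injOn (fun τ : Equiv.Perm (Fin 4) ↦ (τ : Fin 4 → Fin 4))
      (fun σ _ τ _ h ↦ DFunLike.coe_injective h) (by simp) (fun f _ hf ↦ ?_) (fun _ _ ↦ rfl)
    -- An injective self-map of `Fin 4` is a permutation, so `f` repeats a vector.
    have hinj : ¬ Function.Injective f := fun hinj ↦ hf
      ⟨Equiv.ofBijective f (Finite.injective_iff_bijective.mp hinj), by simp, rfl⟩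
    rw [ν.map_eq_zero_of_not_injective (v ∘ f) fun h ↦ hinj h.of_comp, zero_mul]
  rw [← h]
  have : ∀ τ : Equiv.Perm (Fin 4), ν (v ∘ τ) * ν (w ∘ τ) = ν v * ν w := fun τ ↦ by
    rw [ν.map_perm, ν.map_perm]
    rcases Int.units_eq_one_or (Equiv.Perm.sign τ) with h | h <;> simp [h]
  simp only [this, Finset.sum_const, Finset.card_univ, Fintype.card_perm, Fintype.card_fin]
  norm_num [Nat.factorial]
  ring

/-- The contraction `H^{aa'} H^{bb'} H^{cc'} H^{dd'} ν_{abcd} ν_{a'b'c'd'}` of a four-form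
with itself. -/
theorem sum_alternating_contraction {V : Type*} [AddCommGroup V] [Module ℝ V]
    (c : Module.Basis (Fin 4) ℝ V) (ν : V [⋀^Fin 4]→ₗ[ℝ] ℝ) (H : Matrix (Fin 4) (Fin 4) ℝ) :
    ∑ f : Fin 4 → Fin 4, ∑ f' : Fin 4 → Fin 4,
      (∏ i, H (f i) (f' i)) * ν (c ∘ f) * ν (c ∘ f') = 24 * H.det * ν c ^ 2 := by
  -- Contracting one factor with `H` amounts to evaluating `ν` on the vectors `d i`.
  set d : Fin 4 → V := fun i ↦ ∑ j, H i j • c j with hd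
  have h1 : ∀ f : Fin 4 → Fin 4,
      ∑ f' : Fin 4 → Fin 4, (∏ i, H (f i) (f' i)) * ν (c ∘ f') = ν (d ∘ f) := fun f ↦ by
    have : d ∘ f = fun i ↦ ∑ j, H (f i) j • c j := rfl
    rw [this]
    have h2 := ν.toMultilinearMap.map_sum (fun i j ↦ H (f i) j • c j)
    refine Eq.trans ?_ h2.symm
    refine Finset.sum_congr rfl fun f' _ ↦ ?_
    have h3 := ν.toMultilinearMap.map_smul_univ (fun i ↦ H (f i) (f' i)) (c ∘ f')
    refine Eq.trans ?_ h3.symm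
    simp
  have h2 : ν d = H.det * ν c := by
    rw [ν.eq_smul_basis_det c]
    have : c.toMatrix d = H.transpose := by
      ext i j
      simp [Module.Basis.toMatrix_apply, hd, Finsupp.single_apply]
    simp [Module.Basis.det_apply, this, mul_comm]
  calc _ = ∑ f : Fin 4 → Fin 4, ν (c ∘ f) * ν (d ∘ f) := by
        refine Finset.sum_congr rfl fun f _ ↦ ?_
        rw [← h1, Finset.mul_sum]
        exact Finset.sum_congr rfl fun f' _ ↦ by ring
    _ = _ := by rw [sum_alternating_mul, h2]; ring

/-! ### The square of a self-dual tensor of type D -/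

section SelfDual

variable (G H : Matrix (Fin 4) (Fin 4) ℝ) (E : Fin 4 → Fin 4 → Fin 4 → Fin 4 → ℝ)
  (f : Fin 4 → Fin 4 → ℂ)

/-- The metric `H^{ac} H^{bd}` on tensors with two indices, as a matrix indexed by pairs of
indices. -/
noncomputable abbrev pairMetric : Matrix (Fin 4 × Fin 4) (Fin 4 × Fin 4) ℂ :=
  .of fun p q ↦ ((H p.1 q.1 * H p.2 q.2 : ℝ) : ℂ)

/-- The tensor `𝓘_{abcd}` as a matrix indexed by the pairs `(a, b)` and `(c, d)`. -/
noncomputable abbrev pairId : Matrix (Fin 4 × Fin 4) (Fin 4 × Fin 4) ℂ :=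
  .of fun p q ↦ (1 / 4) * (((G p.1 q.1 * G p.2 q.2 - G p.1 q.2 * G p.2 q.1 : ℝ) : ℂ)
    + Complex.I * (E p.1 p.2 q.1 q.2 : ℂ))

/-- The tensor `ε_{abcd}` as a matrix indexed by the pairs `(a, b)` and `(c, d)`. -/
noncomputable abbrev pairVol : Matrix (Fin 4 × Fin 4) (Fin 4 × Fin 4) ℂ :=
  .of fun p q ↦ (E p.1 p.2 q.1 q.2 : ℂ)

/-- The exchange of the two indices of a tensor `X_{ab}`. -/
noncomputable abbrev pairSwap : Matrix (Fin 4 × Fin 4) (Fin 4 × Fin 4) ℂ :=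
  .of fun p q ↦ if p = q.swap then 1 else 0

variable {G H E f}

theorem pairSwap_mul (X : Matrix (Fin 4 × Fin 4) (Fin 4 × Fin 4) ℂ) :
    pairSwap * X = .of fun p q ↦ X p.swap q := by
  ext p q
  rw [Matrix.mul_apply, Finset.sum_eq_single p.swap]
  · simp
  · intro r _ hr
    have : p ≠ r.swap := fun h ↦ hr (by rw [h, Prod.swap_swap])
    simp [this]
  · simp

theorem pairSwap_mulVec (φ : Fin 4 × Fin 4 → ℂ) :
    Matrix.mulVec pairSwap φ = fun p ↦ φ p.swap := by
  ext p
  rw [Matrix.mulVec, dotProduct, Finset.sum_eq_single p.swap]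
  · simp
  · intro r _ hr
    have : p ≠ r.swap := fun h ↦ hr (by rw [h, Prod.swap_swap])
    simp [this]
  · simp

/-- The endomorphism `X ↦ 𝓘 X` of the tensors with two indices, with the metric part
`g_{ac} g_{bd} - g_{ad} g_{bc}` evaluated to the antisymmetrization `1 - pairSwap`. -/
theorem pairId_mul_pairMetric (hGH : G * H = 1) :
    pairId G E * pairMetric H
      = (1 / 4 : ℂ) • (1 - pairSwap + Complex.I • (pairVol E * pairMetric H)) := by
  have key : ∀ a b, ∑ k, G a k * H k b = if a = b then 1 else 0 := fun a b ↦ by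
    rw [← Matrix.mul_apply, hGH, Matrix.one_apply]
  have hA : (Matrix.of fun p q : Fin 4 × Fin 4 ↦
      ((G p.1 q.1 * G p.2 q.2 - G p.1 q.2 * G p.2 q.1 : ℝ) : ℂ)) * pairMetric H
        = 1 - pairSwap := by
    ext ⟨a, b⟩ ⟨c, d⟩
    have : ∑ q : Fin 4 × Fin 4, (G a q.1 * G b q.2 - G a q.2 * G b q.1) * (H q.1 c * H q.2 d)
        = (∑ k, G a k * H k c) * (∑ l, G b l * H l d)
          - (∑ l, G a l * H l d) * (∑ k, G b k * H k c) := by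
      rw [Finset.sum_mul_sum, Finset.sum_mul_sum,
        Finset.sum_comm (f := fun i j ↦ G a i * H i d * (G b j * H j c)),
        ← Finset.sum_sub_distrib, Fintype.sum_prod_type]
      refine Finset.sum_congr rfl fun k _ ↦ ?_
      rw [← Finset.sum_sub_distrib]
      exact Finset.sum_congr rfl fun l _ ↦ by ring
    rw [Matrix.mul_apply]
    simp only [Matrix.of_apply, ← Complex.ofReal_mul, ← Complex.ofReal_sum]
    rw [this]
    simp only [key, Matrix.sub_apply, Matrix.one_apply, Matrix.of_apply, Prod.swap_prod_mk,
      Prod.mk.injEq]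
    split_ifs <;> simp_all
  have hI : pairId G E = (1 / 4 : ℂ) • ((Matrix.of fun p q : Fin 4 × Fin 4 ↦
      ((G p.1 q.1 * G p.2 q.2 - G p.1 q.2 * G p.2 q.1 : ℝ) : ℂ)) + Complex.I • pairVol E) := by
    ext p q
    simp
  rw [hI, Matrix.smul_mul, Matrix.add_mul, hA, Matrix.smul_mul]

/-- A full contraction of two tensors with four indices is a trace, if they are read as matrices
indexed by pairs. -/
theorem pair_contraction (X Y Z : Matrix (Fin 4 × Fin 4) (Fin 4 × Fin 4) ℂ) (hZ : Z.transpose = Z)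
    (hY : Y.transpose = Y) :
    ∑ p, ∑ q, ∑ p', ∑ q', Z p p' * Z q q' * X p' q' * Y p q = ((Y * Z) * (X * Z)).trace := by
  have hZ' : ∀ p q, Z p q = Z q p := fun p q ↦ congrFun (congrFun hZ q) p
  have hY' : ∀ p q, Y p q = Y q p := fun p q ↦ congrFun (congrFun hY q) p
  simp only [Matrix.trace, Matrix.diag_apply]
  rw [Finset.sum_comm]
  refine Finset.sum_congr rfl fun q _ ↦ ?_
  rw [Matrix.mul_apply, Finset.sum_comm]
  refine Finset.sum_congr rfl fun p' _ ↦ ?_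
  rw [Matrix.mul_apply, Matrix.mul_apply, Finset.sum_mul_sum]
  refine Finset.sum_congr rfl fun p _ ↦ Finset.sum_congr rfl fun q' _ ↦ ?_
  rw [hY' p q, hZ' q q']
  ring

/-- The tensor `D = f ⊗ f - ⅓ f² 𝓘` of a self-dual two-form `f` has square `D² = ⅔ (f²)²`. Here
`G`, `H` and `E` are the components of the metric, of its inverse and of the volume form; that the
metric has Lorentzian signature enters through the value `-24` of the contraction of `E` with
itself. -/
theorem selfDual_contraction (hG : ∀ a b, G a b = G b a) (hH : ∀ a b, H a b = H b a)
    (hGH : G * H = 1)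
    (hE₁ : ∀ a b c d, E b a c d = -E a b c d) (hE₂ : ∀ a b c d, E c d a b = E a b c d)
    (hE₃ : ∀ a b c d, E c b a d = -E a b c d)
    (hEE : ∑ a, ∑ b, ∑ c, ∑ d, ∑ a', ∑ b', ∑ c', ∑ d',
      H a a' * H b b' * H c c' * H d d' * E a b c d * E a' b' c' d' = -24)
    (hf : ∀ a b, f a b = -f b a)
    (hsd : ∀ a b, f a b = Complex.I * ((1 / 2) * ∑ c, ∑ d,
      ((∑ m, ∑ n, E a b m n * H m c * H n d : ℝ) : ℂ) * f c d))
    {u : ℂ} (hu : u = ∑ a, ∑ b, ∑ a', ∑ b', (H a a' * H b b' : ℝ) * f a' b' * f a b)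
    {D : Fin 4 → Fin 4 → Fin 4 → Fin 4 → ℂ}
    (hD : ∀ a b c d, D a b c d = f a b * f c d - (1 / 3) * u * ((1 / 4) *
      ((G a c * G b d - G a d * G b c : ℝ) + Complex.I * (E a b c d : ℂ)))) :
    ∑ a, ∑ b, ∑ c, ∑ d, ∑ a', ∑ b', ∑ c', ∑ d',
      (H a a' * H b b' * H c c' * H d d' : ℝ) * D a' b' c' d' * D a b c d = (2 / 3) * u ^ 2 := by
  set K := pairMetric H with hK
  set X := pairVol E * K with hX
  set φ : Fin 4 × Fin 4 → ℂ := fun p ↦ f p.1 p.2 with hφ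
  set J := pairId G E with hJ
  set T : Matrix (Fin 4 × Fin 4) (Fin 4 × Fin 4) ℂ := .of fun p q ↦ D p.1 p.2 q.1 q.2 with hT
  have hKt : K.transpose = K := by
    ext p q; simp [hK, hH q.1 p.1, hH q.2 p.2]
  have hEt : (pairVol E).transpose = pairVol E := by
    ext p q; simp [hE₂ p.1 p.2 q.1 q.2]
  have hTd : T = Matrix.vecMulVec φ φ - (u / 3) • J := by
    ext p q
    simp only [hT, Matrix.of_apply, hD, Matrix.sub_apply, Matrix.vecMulVec_apply, hφ, hJ,
      Matrix.smul_apply, smul_eq_mul]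
    ring
  have hTt : T.transpose = T := by
    ext p q
    simp only [hT, Matrix.transpose_apply, Matrix.of_apply, hD, hE₂ p.1 p.2 q.1 q.2,
      hG q.1 p.1, hG q.2 p.2, hG q.1 p.2, hG q.2 p.1]
    push_cast
    ring
  have hSX : pairSwap * X = -X := by
    rw [hX, ← Matrix.mul_assoc, pairSwap_mul, ← Matrix.neg_mul]
    congr 1
    ext p q
    simp [hE₁ p.1 p.2]
  have hSS : (pairSwap : Matrix (Fin 4 × Fin 4) (Fin 4 × Fin 4) ℂ) * pairSwap = 1 := by
    rw [pairSwap_mul]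
    ext p q
    simp [Matrix.one_apply, Prod.swap_inj]
  have hSφ : Matrix.mulVec pairSwap φ = -φ := by
    rw [pairSwap_mulVec]
    ext p
    simp [hφ, hf p.2 p.1]
  have hXφ : Matrix.mulVec (Complex.I • X) φ = (2 : ℂ) • φ := by
    ext ⟨a, b⟩
    have h1 := hsd a b
    rw [Matrix.smul_mulVec, Pi.smul_apply, Pi.smul_apply, Matrix.mulVec, dotProduct]
    simp only [hφ, smul_eq_mul]
    have h2 : ∑ q : Fin 4 × Fin 4, X (a, b) q * f q.1 q.2
        = ∑ c, ∑ d, ((∑ m, ∑ n, E a b m n * H m c * H n d : ℝ) : ℂ) * f c d := by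
      rw [Fintype.sum_prod_type]
      refine Finset.sum_congr rfl fun c _ ↦ Finset.sum_congr rfl fun d _ ↦ ?_
      rw [hX, Matrix.mul_apply, Fintype.sum_prod_type]
      simp [hK, mul_assoc]
    rw [h2]
    linear_combination (-2 : ℂ) * h1
  have hJK : J * K = (1 / 4 : ℂ) • (1 - pairSwap + Complex.I • X) := pairId_mul_pairMetric hGH
  -- `𝓘` fixes self-dual two-forms.
  have hJφ : Matrix.mulVec (J * K) φ = φ := by
    rw [hJK, Matrix.smul_mulVec, Matrix.add_mulVec, Matrix.sub_mulVec, hXφ, hSφ,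
      Matrix.one_mulVec]
    ext p
    simp
    ring
  have huK : dotProduct (Matrix.vecMul φ K) φ = u := by
    rw [hu, ← Matrix.dotProduct_mulVec, dotProduct, Fintype.sum_prod_type]
    refine Finset.sum_congr rfl fun a _ ↦ Finset.sum_congr rfl fun b _ ↦ ?_
    rw [Matrix.mulVec, dotProduct, Fintype.sum_prod_type, Finset.mul_sum]
    refine Finset.sum_congr rfl fun a' _ ↦ ?_
    rw [Finset.mul_sum]
    refine Finset.sum_congr rfl fun b' _ ↦ ?_
    simp [hφ, hK]
    ring
  -- `ε_{abcd}` is antisymmetric and `H^{ac}` is symmetric in `a`, `c`.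
  have htrX : X.trace = 0 := by
    have h : X.trace = -X.trace := by
      have h1 : X.trace = ∑ a, ∑ b, ∑ c, ∑ d, (E a b c d * (H c a * H d b) : ℂ) := by
        simp [Matrix.trace, hX, hK, Matrix.mul_apply, Fintype.sum_prod_type]
      have h2 : X.trace = ∑ a, ∑ b, ∑ c, ∑ d, (E c b a d * (H a c * H d b) : ℂ) := by
        rw [h1]
        rw [Finset.sum_comm]
        conv_rhs => rw [Finset.sum_comm]
        exact Finset.sum_congr rfl fun b _ ↦ by rw [Finset.sum_comm]
      calc X.trace = _ := h2
        _ = -∑ a, ∑ b, ∑ c, ∑ d, (E a b c d * (H c a * H d b) : ℂ) := by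
          simp only [← Finset.sum_neg_distrib]
          refine Finset.sum_congr rfl fun a _ ↦ Finset.sum_congr rfl fun b _ ↦
            Finset.sum_congr rfl fun c _ ↦ Finset.sum_congr rfl fun d _ ↦ ?_
          rw [hE₃, hH a c]
          push_cast
          ring
        _ = -X.trace := by rw [h1]
    exact self_eq_neg.mp h
  have htrS : (pairSwap : Matrix (Fin 4 × Fin 4) (Fin 4 × Fin 4) ℂ).trace = 4 := by
    simp only [Matrix.trace, Matrix.diag_apply, Matrix.of_apply, Fintype.sum_prod_type,
      Prod.swap_prod_mk, Prod.mk.injEq]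
    have : ∀ a b : Fin 4, (if a = b ∧ b = a then (1 : ℂ) else 0) = if a = b then 1 else 0 :=
      fun a b ↦ by simp [eq_comm (a := b) (b := a)]
    simp [this]
  have htrXX : (X * X).trace = -24 := by
    rw [hX, ← pair_contraction _ _ _ hKt hEt]
    simp only [Fintype.sum_prod_type]
    have := congrArg (fun r : ℝ ↦ (r : ℂ)) hEE
    push_cast at this
    rw [← this]
    refine Finset.sum_congr rfl fun a _ ↦ Finset.sum_congr rfl fun b _ ↦
      Finset.sum_congr rfl fun c _ ↦ Finset.sum_congr rfl fun d _ ↦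
      Finset.sum_congr rfl fun a' _ ↦ Finset.sum_congr rfl fun b' _ ↦
      Finset.sum_congr rfl fun c' _ ↦ Finset.sum_congr rfl fun d' _ ↦ ?_
    simp [hK]
    ring
  have htrJ : ((J * K) * (J * K)).trace = 3 := by
    have h : ((1 : Matrix (Fin 4 × Fin 4) (Fin 4 × Fin 4) ℂ) - pairSwap + Complex.I • X)
        * (1 - pairSwap + Complex.I • X) = 1 - pairSwap - pairSwap + pairSwap * pairSwap
          + Complex.I • X + Complex.I • X - Complex.I • (pairSwap * X)
          - Complex.I • (X * pairSwap) - X * X := by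
      simp only [Matrix.add_mul, Matrix.mul_add, Matrix.sub_mul, Matrix.mul_sub, Matrix.one_mul,
        Matrix.mul_one, Matrix.smul_mul, Matrix.mul_smul]
      have hI : ∀ Y : Matrix (Fin 4 × Fin 4) (Fin 4 × Fin 4) ℂ,
          Complex.I • Complex.I • Y = -Y := fun Y ↦ by
        rw [smul_smul, Complex.I_mul_I, neg_one_smul]
      simp only [smul_add, smul_sub, hI]
      abel
    rw [hJK, Matrix.smul_mul, Matrix.mul_smul, h]
    simp only [Matrix.trace_smul, Matrix.trace_sub, Matrix.trace_add, hSS, hSX, Matrix.trace_neg,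
      Matrix.trace_mul_comm X pairSwap, htrX, htrS, htrXX, Matrix.trace_one]
    norm_num
  have hTK : T * K = Matrix.vecMulVec φ (Matrix.vecMul φ K) - (u / 3) • (J * K) := by
    rw [hTd, Matrix.sub_mul, Matrix.smul_mul, Matrix.vecMulVec_mul]
  have hcross : (Matrix.vecMulVec φ (Matrix.vecMul φ K) * (J * K)).trace = u := by
    rw [Matrix.trace_mul_comm, Matrix.mul_vecMulVec, hJφ, Matrix.trace_vecMulVec,
      dotProduct_comm, huK]
  have hsq : (Matrix.vecMulVec φ (Matrix.vecMul φ K)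
      * Matrix.vecMulVec φ (Matrix.vecMul φ K)).trace = u ^ 2 := by
    rw [Matrix.vecMulVec_mul_vecMulVec, huK]
    simp [Matrix.trace_vecMulVec, dotProduct_comm φ, huK]
    ring
  calc _ = ∑ p, ∑ q, ∑ p', ∑ q', K p p' * K q q' * T p' q' * T p q := by
        simp only [Fintype.sum_prod_type]
        refine Finset.sum_congr rfl fun a _ ↦ Finset.sum_congr rfl fun b _ ↦
          Finset.sum_congr rfl fun c _ ↦ Finset.sum_congr rfl fun d _ ↦
          Finset.sum_congr rfl fun a' _ ↦ Finset.sum_congr rfl fun b' _ ↦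
          Finset.sum_congr rfl fun c' _ ↦ Finset.sum_congr rfl fun d' _ ↦ ?_
        simp only [hK, hT, Matrix.of_apply]
        push_cast
        ring
    _ = ((T * K) * (T * K)).trace := pair_contraction _ _ _ hKt hTt
    _ = _ := by
        rw [hTK, Matrix.sub_mul, Matrix.mul_sub, Matrix.mul_sub]
        simp only [Matrix.trace_sub, Matrix.smul_mul, Matrix.mul_smul, Matrix.trace_smul, hsq,
          hcross, htrJ, Matrix.trace_mul_comm (J * K) (Matrix.vecMulVec φ _), smul_eq_mul]
        ring

end SelfDual

/-! ### Frames, the invariance of `ℱ²` and the value of `𝒞²` -/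

section Pointwise

variable {M : Type*} [TopologicalSpace M] [ChartedSpace E4 M] [IsManifold 𝓘(ℝ, E4) ∞ M]

theorem exists_basis_coordVec {e : OpenPartialHomeomorph M E4} (he : e ∈ atlas E4 M) {y : E4}
    (hy : y ∈ e.target) :
    ∃ c : Module.Basis (Fin 4) ℝ (TangentSpace 𝓘(ℝ, E4) (e.symm y)),
      ∀ i, c i = coordVec e y i := by
  have : IsManifold 𝓘(ℝ, E4) 1 M := IsManifold.of_le (n := ∞) (by simp)
  have hd : e.symm.MDifferentiable 𝓘(ℝ, E4) 𝓘(ℝ, E4) :=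
    (mdifferentiable_of_mem_atlas (I := 𝓘(ℝ, E4)) he).symm
  let L : E4 ≃L[ℝ] TangentSpace 𝓘(ℝ, E4) (e.symm y) := hd.mfderiv (x := y) hy
  refine ⟨(EuclideanSpace.basisFun (Fin 4) ℝ).toBasis.map L.toLinearEquiv, fun i ↦ ?_⟩
  rw [Module.Basis.map_apply, OrthonormalBasis.coe_toBasis, EuclideanSpace.basisFun_apply]
  rfl

/-- The Minkowski matrix `diag(-1, 1, 1, 1)` as an element of `Matrix`. -/
noncomputable def etaMatrix : Matrix (Fin 4) (Fin 4) ℝ := .of eta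

theorem etaMatrix_eq_diagonal :
    etaMatrix = Matrix.diagonal fun i ↦ if i = 0 then (-1 : ℝ) else 1 := by
  ext i j
  simp [etaMatrix, eta, Matrix.diagonal_apply]

theorem etaMatrix_mul_self : etaMatrix * etaMatrix = 1 := by
  rw [etaMatrix_eq_diagonal, Matrix.diagonal_mul_diagonal, ← Matrix.diagonal_one]
  congr 1
  ext i
  split_ifs <;> norm_num

theorem det_etaMatrix : etaMatrix.det = -1 := by
  rw [etaMatrix_eq_diagonal, Matrix.det_diagonal]
  simp

variable (g : LorentzMetric M) (e : OpenPartialHomeomorph M E4) (y : E4)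

/-- The matrix of the components `g_{ab}` at the point with coordinates `y`. -/
noncomputable def gram : Matrix (Fin 4) (Fin 4) ℝ := .of fun a b ↦ metric g e y a b

theorem metricInv_eq (a b : Fin 4) : metricInv g e y a b = (gram g e y)⁻¹ a b := rfl

variable {e y}

theorem gram_eq (c b : Module.Basis (Fin 4) ℝ (TangentSpace 𝓘(ℝ, E4) (e.symm y)))
    (hc : ∀ i, c i = coordVec e y i) (hb : ∀ i j, g.val (e.symm y) (b i) (b j) = eta i j) :
    gram g e y = (b.toMatrix c).transpose * etaMatrix * b.toMatrix c := by
  ext i j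
  change g.val (e.symm y) (coordVec e y i) (coordVec e y j) = _
  rw [← hc, ← hc, ← b.sum_toMatrix_smul_self c i, ← b.sum_toMatrix_smul_self c j]
  simp only [map_sum, map_smul, sum_apply, smul_apply, hb,
    Matrix.mul_apply, Matrix.transpose_apply, smul_eq_mul, etaMatrix, Matrix.of_apply,
    Finset.sum_mul, Finset.mul_sum]
  exact Finset.sum_congr rfl fun k _ ↦ Finset.sum_congr rfl fun l _ ↦ by ring

theorem isUnit_det_toMatrix {V : Type*} [AddCommGroup V] [Module ℝ V]
    (b c : Module.Basis (Fin 4) ℝ V) : IsUnit (b.toMatrix c).det := by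
  rw [← Module.Basis.det_apply]
  exact b.isUnit_det c

/-- The inverse metric, transformed from the coordinate basis `c` to an orthonormal basis `b`. -/
theorem toMatrix_mul_inv_gram (c b : Module.Basis (Fin 4) ℝ (TangentSpace 𝓘(ℝ, E4) (e.symm y)))
    (hc : ∀ i, c i = coordVec e y i) (hb : ∀ i j, g.val (e.symm y) (b i) (b j) = eta i j) :
    b.toMatrix c * (gram g e y)⁻¹ * (b.toMatrix c).transpose = etaMatrix := by
  have hR := isUnit_det_toMatrix b c
  have hRt : IsUnit (b.toMatrix c).transpose.det := by rwa [Matrix.det_transpose]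
  have hN : etaMatrix⁻¹ = etaMatrix := Matrix.inv_eq_left_inv etaMatrix_mul_self
  rw [gram_eq g c b hc hb, Matrix.mul_inv_rev, Matrix.mul_inv_rev, hN, ← Matrix.mul_assoc,
    Matrix.mul_nonsing_inv _ hR, Matrix.one_mul, Matrix.mul_assoc,
    Matrix.nonsing_inv_mul _ hRt, Matrix.mul_one]

theorem isUnit_det_gram (he : e ∈ atlas E4 M) (hy : y ∈ e.target) :
    IsUnit (gram g e y).det := by
  obtain ⟨c, hc⟩ := exists_basis_coordVec he hy
  obtain ⟨b, hb⟩ := g.lorentz (e.symm y)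
  have hR := isUnit_det_toMatrix b c
  rw [gram_eq g c b hc hb, Matrix.det_mul, Matrix.det_mul, Matrix.det_transpose, det_etaMatrix]
  exact (hR.mul (by norm_num)).mul hR

theorem gram_transpose : (gram g e y).transpose = gram g e y := by
  ext a b
  exact g.symm _ _ _

/-- The scalar `ℱ²` at `x`, computed in a chosen orthonormal basis of the tangent space at `x`. It
refers to no chart. -/
noncomputable def frameSq (F : ComplexTwoForm M) (x : M) : ℂ :=
  ((Matrix.of fun i j ↦ F.val x ((g.lorentz x).choose i) ((g.lorentz x).choose j)).transpose
    * etaMatrix.map Complex.ofReal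
    * (Matrix.of fun i j ↦ F.val x ((g.lorentz x).choose i) ((g.lorentz x).choose j))
    * etaMatrix.map Complex.ofReal).trace

theorem formSqIn_eq_frameSq (he : e ∈ atlas E4 M) (hy : y ∈ e.target) (F : ComplexTwoForm M) :
    formSqIn g e F y = frameSq g F (e.symm y) := by
  obtain ⟨c, hc⟩ := exists_basis_coordVec he hy
  unfold frameSq
  set b := (g.lorentz (e.symm y)).choose with hbdef
  have hb := (g.lorentz (e.symm y)).choose_spec
  rw [← hbdef] at hb
  set f : Matrix (Fin 4) (Fin 4) ℂ := .of (formComp e F y) with hf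
  set f' : Matrix (Fin 4) (Fin 4) ℂ := .of fun i j ↦ F.val (e.symm y) (b i) (b j) with hf'
  set R := (b.toMatrix c).map Complex.ofReal with hR
  set H := ((gram g e y)⁻¹).map Complex.ofReal with hH
  have h1 : f = R.transpose * f' * R := by
    ext i j
    change F.val (e.symm y) (coordVec e y i) (coordVec e y j) = _
    rw [← hc, ← hc, ← b.sum_toMatrix_smul_self c i, ← b.sum_toMatrix_smul_self c j]
    simp only [map_sum, map_smul, sum_apply, smul_apply,
      Matrix.mul_apply, Matrix.transpose_apply, hR, hf', Matrix.of_apply, Matrix.map_apply,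
      Finset.sum_mul, Finset.mul_sum, Complex.real_smul]
    exact Finset.sum_congr rfl fun k _ ↦ Finset.sum_congr rfl fun l _ ↦ by ring
  have h2 : R * H * R.transpose = etaMatrix.map Complex.ofReal := by
    rw [← toMatrix_mul_inv_gram g c b hc hb]
    ext i j
    simp [hR, hH, Matrix.mul_apply]
  have hHt : H.transpose = H := by
    ext i j
    have := congrFun (congrFun (Matrix.transpose_nonsing_inv (gram g e y)) i) j
    rw [gram_transpose] at this
    simp only [hH, Matrix.transpose_apply, Matrix.map_apply] at this ⊢
    rw [this]
  have h3 : formSqIn g e F y = (f.transpose * H * f * H).trace := by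
    have : f.transpose * H * f * H = f.transpose * (H * f * H) := by simp [Matrix.mul_assoc]
    rw [this, Matrix.trace_mul_comm, Matrix.trace]
    unfold formSqIn
    refine Finset.sum_congr rfl fun a _ ↦ ?_
    rw [Matrix.diag_apply, Matrix.mul_apply]
    refine Finset.sum_congr rfl fun b _ ↦ ?_
    rw [Matrix.mul_apply, Finset.sum_comm, Finset.sum_mul]
    refine Finset.sum_congr rfl fun b' _ ↦ ?_
    rw [Matrix.mul_apply, Finset.sum_mul, Finset.sum_mul]
    refine Finset.sum_congr rfl fun a' _ ↦ ?_
    have hs : H b' b = H b b' := congrFun (congrFun hHt b) b'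
    rw [hs]
    simp only [hf, hH, metricInv_eq, Matrix.of_apply, Matrix.map_apply, Matrix.transpose_apply]
    push_cast
    ring
  rw [h3, ← h2, h1]
  simp only [Matrix.transpose_mul, Matrix.transpose_transpose]
  simp only [Matrix.mul_assoc]
  rw [Matrix.trace_mul_comm]
  simp only [Matrix.mul_assoc]

/-- The scalar `ℱ²` may be computed in any chart of the atlas. -/
theorem formSqIn_eq_formSq (he : e ∈ atlas E4 M) (hy : y ∈ e.target) (F : ComplexTwoForm M) :
    formSqIn g e F y = formSq g F (e.symm y) := by
  rw [formSqIn_eq_frameSq g he hy, formSq, formSqIn_eq_frameSq g (chart_mem_atlas _ _)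
    (mem_chart_target _ _), OpenPartialHomeomorph.left_inv _ (mem_chart_source _ _)]

variable {g} (ε : VolumeForm g)

/-- `ε^{abcd} ε_{abcd} = -24`: the sign is that of the determinant of a Lorentzian metric. -/
theorem vol_contraction (he : e ∈ atlas E4 M) (hy : y ∈ e.target) :
    ∑ a, ∑ b, ∑ c, ∑ d, ∑ a', ∑ b', ∑ c', ∑ d',
      metricInv g e y a a' * metricInv g e y b b' * metricInv g e y c c' * metricInv g e y d d'
        * vol e ε y a b c d * vol e ε y a' b' c' d' = -24 := by
  obtain ⟨c, hc⟩ := exists_basis_coordVec he hy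
  obtain ⟨b, hb⟩ := g.lorentz (e.symm y)
  have h := sum_alternating_contraction c (ε.val (e.symm y)) (gram g e y)⁻¹
  have hvol : ∀ i j k l, ε.val (e.symm y) (c ∘ ![i, j, k, l]) = vol e ε y i j k l := by
    intro i j k l
    rw [vol]
    congr 1
    ext m
    fin_cases m <;> simp [hc]
  have hdet : (gram g e y)⁻¹.det * ε.val (e.symm y) c ^ 2 = -1 := by
    have h1 : ε.val (e.symm y) c = ε.val (e.symm y) b * (b.toMatrix c).det := by
      conv_lhs => rw [(ε.val (e.symm y)).eq_smul_basis_det b]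
      simp [Module.Basis.det_apply]
    have h2 : ε.val (e.symm y) b ^ 2 = 1 := by
      rw [← sq_abs, ε.unit _ b hb, one_pow]
    have h3 := congrArg Matrix.det (toMatrix_mul_inv_gram g c b hc hb)
    rw [Matrix.det_mul, Matrix.det_mul, Matrix.det_transpose, det_etaMatrix] at h3
    rw [h1, mul_pow, h2]
    linear_combination h3
  rw [mul_assoc, hdet, sum_pi_fin_four] at h
  simp only [sum_pi_fin_four, hvol, Fin.prod_univ_four] at h
  rw [show (-24 : ℝ) = 24 * -1 by norm_num, ← h]
  rfl

theorem vol_swap_first (a b c d : Fin 4) : vol e ε y b a c d = -vol e ε y a b c d := by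
  rw [vol, vol, ← AlternatingMap.map_swap _ _ (show (0 : Fin 4) ≠ 1 by decide)]
  congr 1
  ext i
  fin_cases i <;> rfl

theorem vol_swap_outer (a b c d : Fin 4) : vol e ε y c b a d = -vol e ε y a b c d := by
  rw [vol, vol, ← AlternatingMap.map_swap _ _ (show (0 : Fin 4) ≠ 2 by decide)]
  congr 1
  ext i
  fin_cases i <;> rfl

theorem vol_swap_pairs (a b c d : Fin 4) : vol e ε y c d a b = vol e ε y a b c d := by
  have : vol e ε y c d a b = -vol e ε y c b a d := by
    rw [vol, vol, ← AlternatingMap.map_swap _ _ (show (1 : Fin 4) ≠ 3 by decide)]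
    congr 1
    ext i
    fin_cases i <;> rfl
  rw [this, vol_swap_outer, neg_neg]

variable (e y) in
/-- The tensor `ℱ ⊗ ℱ - ⅓ ℱ² 𝓘`. -/
noncomputable def modelWeyl (F : ComplexTwoForm M) (a b c d : Fin 4) : ℂ :=
  formComp e F y a b * formComp e F y c d - (1 / 3) * formSqIn g e F y * sdId e ε y a b c d

variable {ε} {F : ComplexTwoForm M} {Q : M → ℂ}

theorem sdWeyl_eq (hS : MSTVanishes ε F Q) (he : e ∈ atlas E4 M) (hy : y ∈ e.target)
    (a b c d : Fin 4) :
    sdWeyl e ε y a b c d = Q (e.symm y) * modelWeyl e y ε F a b c d :=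
  sub_eq_zero.mp (hS e he y hy a b c d)

theorem weylSqIn_eq (hF : IsSelfDual ε F) (hS : MSTVanishes ε F Q) (he : e ∈ atlas E4 M)
    (hy : y ∈ e.target) :
    weylSqIn e ε y = (2 / 3) * (Q (e.symm y) * formSqIn g e F y) ^ 2 := by
  have hdet := isUnit_det_gram g he hy
  have h := selfDual_contraction (G := gram g e y) (H := (gram g e y)⁻¹) (E := vol e ε y)
    (f := formComp e F y) (fun a b ↦ g.symm _ _ _) (fun a b ↦ by
      have := congrFun (congrFun (Matrix.transpose_nonsing_inv (gram g e y)) b) a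
      rwa [gram_transpose] at this) (Matrix.mul_nonsing_inv _ hdet)
    (vol_swap_first ε) (vol_swap_pairs ε) (vol_swap_outer ε) (vol_contraction ε he hy)
    (fun a b ↦ F.antisymm _ _ _) (hF e he y hy) (u := formSqIn g e F y) rfl
    (D := modelWeyl e y ε F) (fun a b c d ↦ rfl)
  rw [mul_pow, mul_left_comm, ← h, weylSqIn]
  simp only [sdWeyl_eq hS he hy, Finset.mul_sum]
  refine Finset.sum_congr rfl fun a _ ↦ Finset.sum_congr rfl fun b _ ↦
      Finset.sum_congr rfl fun c _ ↦ Finset.sum_congr rfl fun d _ ↦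
      Finset.sum_congr rfl fun a' _ ↦ Finset.sum_congr rfl fun b' _ ↦
      Finset.sum_congr rfl fun c' _ ↦ Finset.sum_congr rfl fun d' _ ↦ ?_
  simp only [metricInv_eq]
  ring

theorem weylSq_eq (hF : IsSelfDual ε F) (hS : MSTVanishes ε F Q) (x : M) :
    weylSq ε x = (2 / 3) * (Q x * formSq g F x) ^ 2 := by
  rw [weylSq, weylSqIn_eq hF hS (chart_mem_atlas _ _) (mem_chart_target _ _),
    OpenPartialHomeomorph.left_inv _ (mem_chart_source _ _)]
  rfl

/-- The Weyl tensor is the real part of `𝒞`. -/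
theorem isConformallyFlat_of_eq_zero (hS : MSTVanishes ε F Q) (hQ : ∀ x, Q x = 0) :
    IsConformallyFlat g := by
  intro e he y hy a b c d
  have h := sdWeyl_eq hS he hy a b c d
  rw [hQ, zero_mul, sdWeyl, hodge] at h
  have h2 := congrArg Complex.re h
  have h3 : (∑ i, ∑ j, (volUp e ε y c d i j : ℂ) * (weyl g e y a b i j : ℂ))
      = ((∑ i, ∑ j, volUp e ε y c d i j * weyl g e y a b i j : ℝ) : ℂ) := by push_cast; rfl
  rw [h3] at h2
  simpa [-Complex.ofReal_sum] using h2

end Pointwise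

/-! ### Smoothness of the components in a chart -/

section Smoothness

theorem contDiffOn_pd {f : E4 → ℝ} {s : Set E4} (hs : IsOpen s) (hf : ContDiffOn ℝ ∞ f s)
    (i : Fin 4) : ContDiffOn ℝ ∞ (pd i f) s := by
  have := hf.fderiv_of_isOpen hs (m := ∞) (by simp)
  exact this.clm_apply contDiffOn_const

theorem contDiffOn_det {s : Set E4} {A : E4 → Matrix (Fin 4) (Fin 4) ℝ}
    (hA : ∀ i j, ContDiffOn ℝ ∞ (fun y ↦ A y i j) s) : ContDiffOn ℝ ∞ (fun y ↦ (A y).det) s := by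
  simp only [Matrix.det_apply']
  exact ContDiffOn.sum fun σ _ ↦ contDiffOn_const.mul (contDiffOn_prod fun i _ ↦ hA _ _)

theorem contDiffOn_inv_apply {s : Set E4} {A : E4 → Matrix (Fin 4) (Fin 4) ℝ}
    (hA : ∀ i j, ContDiffOn ℝ ∞ (fun y ↦ A y i j) s) (hdet : ∀ y ∈ s, IsUnit (A y).det)
    (i j : Fin 4) : ContDiffOn ℝ ∞ (fun y ↦ (A y)⁻¹ i j) s := by
  simp only [Matrix.inv_def, Ring.inverse_eq_inv', Matrix.smul_apply, smul_eq_mul,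
    Matrix.adjugate_apply]
  refine ((contDiffOn_det hA).inv fun y hy ↦ (hdet y hy).ne_zero).mul (contDiffOn_det fun k l ↦ ?_)
  by_cases hk : k = j
  · subst hk
    simpa using contDiffOn_const
  · simpa [Matrix.updateRow_ne hk] using hA k l

variable {M : Type*} [TopologicalSpace M] [ChartedSpace E4 M] [IsManifold 𝓘(ℝ, E4) ∞ M]
  {e : OpenPartialHomeomorph M E4}

theorem contMDiffOn_coordVec (he : e ∈ atlas E4 M) (i : Fin 4) :
    ContMDiffOn 𝓘(ℝ, E4) (𝓘(ℝ, E4).prod 𝓘(ℝ, E4)) ∞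
      (fun y ↦ Bundle.TotalSpace.mk' E4 (E := fun x : M ↦ TangentSpace 𝓘(ℝ, E4) x)
        (e.symm y) (coordVec e y i)) e.target := by
  have hsymm : ContMDiffOn 𝓘(ℝ, E4) 𝓘(ℝ, E4) ∞ e.symm e.target :=
    contMDiffOn_symm_of_mem_maximalAtlas (IsManifold.subset_maximalAtlas he)
  have h1 := hsymm.contMDiffOn_tangentMapWithin (m := ∞) (by simp) e.open_target.uniqueMDiffOn
  have h2 : ContMDiff 𝓘(ℝ, E4) 𝓘(ℝ, E4).tangent ∞
      (fun y : E4 ↦ (⟨y, EuclideanSpace.single i (1 : ℝ)⟩ : TangentBundle 𝓘(ℝ, E4) E4)) :=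
    (contMDiff_vectorSpace_iff_contDiff
      (V := fun _ : E4 ↦ (EuclideanSpace.single i (1 : ℝ) : E4))).mpr contDiff_const
  have h3 := h1.comp (h2.contMDiffOn (s := e.target)) fun y hy ↦ hy
  refine h3.congr fun y hy ↦ ?_
  simp only [Function.comp, tangentMapWithin, coordVec]
  rw [mfderivWithin_of_isOpen e.open_target hy]

theorem contDiffOn_bilin {W : Type*} [NormedAddCommGroup W] [NormedSpace ℝ W]
    {B : ∀ x : M, TangentSpace 𝓘(ℝ, E4) x →L[ℝ] TangentSpace 𝓘(ℝ, E4) x →L[ℝ] W}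
    (hB : ContMDiff 𝓘(ℝ, E4) (𝓘(ℝ, E4).prod 𝓘(ℝ, E4 →L[ℝ] E4 →L[ℝ] W)) ∞
      (fun x ↦ Bundle.TotalSpace.mk' (E4 →L[ℝ] E4 →L[ℝ] W)
        (E := fun x : M ↦ TangentSpace 𝓘(ℝ, E4) x →L[ℝ] TangentSpace 𝓘(ℝ, E4) x →L[ℝ] W) x (B x)))
    (he : e ∈ atlas E4 M) (i j : Fin 4) :
    ContDiffOn ℝ ∞ (fun y ↦ B (e.symm y) (coordVec e y i) (coordVec e y j)) e.target := by
  have hsymm : ContMDiffOn 𝓘(ℝ, E4) 𝓘(ℝ, E4) ∞ e.symm e.target :=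
    contMDiffOn_symm_of_mem_maximalAtlas (IsManifold.subset_maximalAtlas he)
  have h := ContMDiffOn.clm_bundle_apply₂ (F₁ := E4) (F₂ := E4) (F₃ := W)
    (E₁ := fun x : M ↦ TangentSpace 𝓘(ℝ, E4) x) (E₂ := fun x : M ↦ TangentSpace 𝓘(ℝ, E4) x)
    (E₃ := Bundle.Trivial M W) (b := e.symm) (s := e.target)
    (ψ := fun y ↦ B (e.symm y)) (hB.comp_contMDiffOn hsymm)
    (contMDiffOn_coordVec he i) (contMDiffOn_coordVec he j)
  rw [← contMDiffOn_iff_contDiffOn]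
  intro y hy
  have h' := h y hy
  rw [Bundle.contMDiffWithinAt_totalSpace] at h'
  simpa using h'.2

theorem contDiffOn_metric (g : LorentzMetric M) (he : e ∈ atlas E4 M) (i j : Fin 4) :
    ContDiffOn ℝ ∞ (fun y ↦ metric g e y i j) e.target :=
  contDiffOn_bilin g.smooth he i j

theorem contDiffOn_formComp (F : ComplexTwoForm M) (he : e ∈ atlas E4 M) (i j : Fin 4) :
    ContDiffOn ℝ ∞ (fun y ↦ formComp e F y i j) e.target :=
  contDiffOn_bilin F.smooth he i j

theorem contDiffOn_metricInv (g : LorentzMetric M) (he : e ∈ atlas E4 M) (i j : Fin 4) :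
    ContDiffOn ℝ ∞ (fun y ↦ metricInv g e y i j) e.target :=
  contDiffOn_inv_apply (A := gram g e) (fun i j ↦ contDiffOn_metric g he i j)
    (fun _ hy ↦ isUnit_det_gram g he hy) i j

theorem contDiffOn_christoffel (g : LorentzMetric M) (he : e ∈ atlas E4 M) (k i j : Fin 4) :
    ContDiffOn ℝ ∞ (christoffel g e k i j) e.target := by
  have hg := fun l i j ↦ contDiffOn_pd e.open_target (contDiffOn_metric g he i j) l
  have hi := contDiffOn_metricInv g he
  unfold christoffel
  exact contDiffOn_const.mul (ContDiffOn.sum fun l _ ↦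
    (hi k l).mul (((hg i j l).add (hg j i l)).sub (hg l i j)))

theorem contDiffOn_riemannUp (g : LorentzMetric M) (he : e ∈ atlas E4 M) (r s m n : Fin 4) :
    ContDiffOn ℝ ∞ (fun y ↦ riemannUp g e y r s m n) e.target := by
  have hc := fun k i j ↦ contDiffOn_christoffel g he k i j
  have hp := fun l k i j ↦ contDiffOn_pd e.open_target (hc k i j) l
  unfold riemannUp
  exact ((hp m r n s).sub (hp n r m s)).add (ContDiffOn.sum fun l _ ↦
    ((hc r m l).mul (hc l n s)).sub ((hc r n l).mul (hc l m s)))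

theorem contDiffOn_weyl (g : LorentzMetric M) (he : e ∈ atlas E4 M) (r s m n : Fin 4) :
    ContDiffOn ℝ ∞ (fun y ↦ weyl g e y r s m n) e.target := by
  have hg := contDiffOn_metric g he
  have hi := contDiffOn_metricInv g he
  have hup := contDiffOn_riemannUp g he
  have hr : ∀ s n, ContDiffOn ℝ ∞ (fun y ↦ ricci g e y s n) e.target := fun s n ↦
    ContDiffOn.sum fun r _ ↦ hup r s r n
  have hsc : ContDiffOn ℝ ∞ (fun y ↦ scalarCurv g e y) e.target :=
    ContDiffOn.sum fun s _ ↦ ContDiffOn.sum fun n _ ↦ (hi s n).mul (hr s n)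
  have hR : ContDiffOn ℝ ∞ (fun y ↦ riemann g e y r s m n) e.target :=
    ContDiffOn.sum fun l _ ↦ (hg r l).mul (hup l s m n)
  unfold weyl
  exact (hR.sub (contDiffOn_const.mul (((((hg r m).mul (hr s n)).sub ((hg r n).mul (hr s m))).sub
    ((hg s m).mul (hr r n))).add ((hg s n).mul (hr r m))))).add ((hsc.div_const 6).mul
      (((hg r m).mul (hg s n)).sub ((hg r n).mul (hg s m))))

variable {g : LorentzMetric M} (ε : VolumeForm g)

theorem contDiffOn_vol (he : e ∈ atlas E4 M) (a b c d : Fin 4) :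
    ContDiffOn ℝ ∞ (fun y ↦ vol e ε y a b c d) e.target := by
  have h : ∀ y, vol e ε y a b c d = ε.val (e.symm y) (coordVec e y ∘ ![a, b, c, d]) := by
    intro y
    rw [vol]
    congr 1
    ext m
    fin_cases m <;> rfl
  simp only [h]
  by_cases hinj : Function.Injective ![a, b, c, d]
  · let τ : Equiv.Perm (Fin 4) := Equiv.ofBijective _ (Finite.injective_iff_bijective.mp hinj)
    have h' : ∀ y, ε.val (e.symm y) (coordVec e y ∘ ![a, b, c, d])
        = Equiv.Perm.sign τ • ε.val (e.symm y) (coordVec e y) := fun y ↦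
      (ε.val (e.symm y)).map_perm (coordVec e y) τ
    simp only [h']
    exact (ε.smooth e he).const_smul _
  · have h' : ∀ y, ε.val (e.symm y) (coordVec e y ∘ ![a, b, c, d]) = 0 := fun y ↦
      (ε.val (e.symm y)).map_eq_zero_of_not_injective _ fun h ↦ hinj h.of_comp
    simp only [h']
    exact contDiffOn_const

theorem contDiffOn_ofReal {f : E4 → ℝ} {s : Set E4} (hf : ContDiffOn ℝ ∞ f s) :
    ContDiffOn ℝ ∞ (fun y ↦ (f y : ℂ)) s :=
  Complex.ofRealCLM.contDiff.comp_contDiffOn hf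

theorem contDiffOn_sdWeyl (he : e ∈ atlas E4 M) (a b m n : Fin 4) :
    ContDiffOn ℝ ∞ (fun y ↦ sdWeyl e ε y a b m n) e.target := by
  have hw := contDiffOn_weyl g he
  have hi := contDiffOn_metricInv g he
  have hv := contDiffOn_vol ε he
  have hvu : ∀ a b c d, ContDiffOn ℝ ∞ (fun y ↦ volUp e ε y a b c d) e.target := fun a b c d ↦
    ContDiffOn.sum fun m _ ↦ ContDiffOn.sum fun n _ ↦ ((hv a b m n).mul (hi m c)).mul (hi n d)
  unfold sdWeyl hodge
  exact (contDiffOn_ofReal (hw a b m n)).add (contDiffOn_const.mul (contDiffOn_const.mul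
    (ContDiffOn.sum fun c _ ↦ ContDiffOn.sum fun d _ ↦
      (contDiffOn_ofReal (hvu m n c d)).mul (contDiffOn_ofReal (hw a b c d)))))

variable (g) in
theorem contDiffOn_formSqIn (F : ComplexTwoForm M) (he : e ∈ atlas E4 M) :
    ContDiffOn ℝ ∞ (fun y ↦ formSqIn g e F y) e.target := by
  have hi := contDiffOn_metricInv g he
  have hf := contDiffOn_formComp F he
  unfold formSqIn
  exact ContDiffOn.sum fun a _ ↦ ContDiffOn.sum fun b _ ↦ ContDiffOn.sum fun a' _ ↦
    ContDiffOn.sum fun b' _ ↦ ((contDiffOn_ofReal ((hi a a').mul (hi b b'))).mul (hf a' b')).mul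
      (hf a b)

theorem contDiffOn_modelWeyl (F : ComplexTwoForm M) (he : e ∈ atlas E4 M) (a b c d : Fin 4) :
    ContDiffOn ℝ ∞ (fun y ↦ modelWeyl e y ε F a b c d) e.target := by
  have hg := contDiffOn_metric g he
  have hf := contDiffOn_formComp F he
  unfold modelWeyl sdId
  exact ((hf a b).mul (hf c d)).sub ((contDiffOn_const.mul (contDiffOn_formSqIn g F he)).mul
    (contDiffOn_const.mul ((contDiffOn_ofReal (((hg a c).mul (hg b d)).sub
      ((hg a d).mul (hg b c)))).add (contDiffOn_const.mul
        (contDiffOn_ofReal (contDiffOn_vol ε he a b c d))))))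

end Smoothness

/-! ### Differentiability of scalars on the manifold -/

section Charts

/-- A function whose derivative vanishes in all charts of a connected manifold is constant. -/
theorem eq_of_fderiv_chart_eq_zero {M : Type*} [TopologicalSpace M] [ChartedSpace E4 M]
    [PreconnectedSpace M] {f : M → ℂ}
    (hf : ∀ e ∈ atlas E4 M, ∀ y ∈ e.target, HasFDerivAt (f ∘ e.symm) (0 : E4 →L[ℝ] ℂ) y)
    (x x' : M) : f x = f x' := by
  refine IsLocallyConstant.apply_eq_of_preconnectedSpace ?_ x x'
  rw [IsLocallyConstant.iff_eventually_eq]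
  intro x
  set e := chartAt E4 x
  have he : e ∈ atlas E4 M := chart_mem_atlas E4 x
  obtain ⟨r, hr, hball⟩ := Metric.isOpen_iff.mp e.open_target (e x) (mem_chart_target E4 x)
  have hcont : ContinuousAt e x := e.continuousAt (mem_chart_source E4 x)
  filter_upwards [e.open_source.mem_nhds (mem_chart_source E4 x),
    hcont.preimage_mem_nhds (Metric.ball_mem_nhds (e x) hr)] with z hz hzr
  have h := Metric.isOpen_ball.is_const_of_fderiv_eq_zero (𝕜 := ℝ) (f := f ∘ e.symm)
    (convex_ball (e x) r).isPreconnected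
    (fun y hy ↦ (hf e he y (hball hy)).differentiableAt.differentiableWithinAt)
    (fun y hy ↦ (hf e he y (hball hy)).fderiv) hzr (Metric.mem_ball_self hr)
  simpa [e.left_inv hz, e.left_inv (mem_chart_source E4 x)] using h

variable {M : Type*} [TopologicalSpace M] [ChartedSpace E4 M] [IsManifold 𝓘(ℝ, E4) ∞ M]

theorem mdifferentiableAt_of_chart {f : M → ℂ} {x : M}
    (hf : DifferentiableAt ℝ (f ∘ (chartAt E4 x).symm) (chartAt E4 x x)) :
    MDifferentiableAt 𝓘(ℝ, E4) 𝓘(ℝ, ℂ) f x := by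
  have : IsManifold 𝓘(ℝ, E4) 1 M := IsManifold.of_le (n := ∞) (by simp)
  have h1 : MDifferentiableAt 𝓘(ℝ, E4) 𝓘(ℝ, E4) (chartAt E4 x) x :=
    mdifferentiableAt_atlas (chart_mem_atlas _ _) (mem_chart_source _ _)
  refine (MDifferentiableAt.comp x hf.mdifferentiableAt h1).congr_of_eventuallyEq ?_
  filter_upwards [(chartAt E4 x).open_source.mem_nhds (mem_chart_source _ _)] with z hz
  simp [(chartAt E4 x).left_inv hz]

/-- The derivative of a function in a chart, in terms of its derivative on the manifold. -/
theorem hasFDerivAt_chart {f : M → ℂ} {e : OpenPartialHomeomorph M E4} (he : e ∈ atlas E4 M)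
    {y : E4} (hy : y ∈ e.target) (hf : MDifferentiableAt 𝓘(ℝ, E4) 𝓘(ℝ, ℂ) f (e.symm y)) :
    HasFDerivAt (f ∘ e.symm) ((show E4 →L[ℝ] ℂ from
      (mfderiv 𝓘(ℝ, E4) 𝓘(ℝ, ℂ) f (e.symm y)).comp (mfderiv 𝓘(ℝ, E4) 𝓘(ℝ, E4) e.symm y))) y := by
  have : IsManifold 𝓘(ℝ, E4) 1 M := IsManifold.of_le (n := ∞) (by simp)
  have h1 : MDifferentiableAt 𝓘(ℝ, E4) 𝓘(ℝ, E4) e.symm y :=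
    mdifferentiableAt_atlas_symm he hy
  exact (hf.hasMFDerivAt.comp y h1.hasMFDerivAt).hasFDerivAt

theorem mfderiv_symm_surjective {e : OpenPartialHomeomorph M E4} (he : e ∈ atlas E4 M) {y : E4}
    (hy : y ∈ e.target) :
    Function.Surjective (mfderiv 𝓘(ℝ, E4) 𝓘(ℝ, E4) e.symm y) := by
  have : IsManifold 𝓘(ℝ, E4) 1 M := IsManifold.of_le (n := ∞) (by simp)
  exact (mdifferentiable_of_mem_atlas (I := 𝓘(ℝ, E4)) he).symm.mfderiv_surjective hy

theorem formSq_comp_symm (g : LorentzMetric M) (F : ComplexTwoForm M)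
    {e : OpenPartialHomeomorph M E4} (he : e ∈ atlas E4 M) :
    Set.EqOn (formSq g F ∘ e.symm) (formSqIn g e F) e.target :=
  fun _ hy ↦ (formSqIn_eq_formSq g he hy F).symm

theorem mdifferentiable_formSq (g : LorentzMetric M) (F : ComplexTwoForm M) :
    MDifferentiable 𝓘(ℝ, E4) 𝓘(ℝ, ℂ) (formSq g F) := by
  intro x
  apply mdifferentiableAt_of_chart
  have he := chart_mem_atlas E4 x
  have hn := (chartAt E4 x).open_target.mem_nhds (mem_chart_target E4 x)
  have hd := ((contDiffOn_formSqIn g F he).contDiffAt hn).differentiableAt (by simp)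
  exact hd.congr_of_eventuallyEq ((formSq_comp_symm g F he).eventuallyEq_of_mem hn)

/-- Near a point with `𝒞² ≠ 0`, the equation `𝒮 = 0` expresses `Q` as the quotient of a component of
`𝒞` by the same component of `ℱ ⊗ ℱ - ⅓ ℱ² 𝓘`. -/
theorem mdifferentiableAt_of_weylSq_ne_zero {g : LorentzMetric M} {ε : VolumeForm g}
    {F : ComplexTwoForm M} {Q : M → ℂ} (hS : MSTVanishes ε F Q) {x : M} (hx : weylSq ε x ≠ 0) :
    MDifferentiableAt 𝓘(ℝ, E4) 𝓘(ℝ, ℂ) Q x := by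
  apply mdifferentiableAt_of_chart
  set e := chartAt E4 x with hedef
  have he : e ∈ atlas E4 M := chart_mem_atlas E4 x
  have hy : e x ∈ e.target := mem_chart_target E4 x
  have hn := e.open_target.mem_nhds hy
  obtain ⟨a, b, c, d, h⟩ : ∃ a b c d, sdWeyl e ε (e x) a b c d ≠ 0 := by
    by_contra! h
    exact hx (by simp [weylSq, weylSqIn, ← hedef, h])
  have hD : modelWeyl e (e x) ε F a b c d ≠ 0 := fun h0 ↦
    h (by rw [sdWeyl_eq hS he hy, h0, mul_zero])
  have hdD : DifferentiableAt ℝ (fun y ↦ modelWeyl e y ε F a b c d) (e x) :=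
    ((contDiffOn_modelWeyl ε F he a b c d).contDiffAt hn).differentiableAt (by simp)
  have hdC : DifferentiableAt ℝ (fun y ↦ sdWeyl e ε y a b c d) (e x) :=
    ((contDiffOn_sdWeyl ε he a b c d).contDiffAt hn).differentiableAt (by simp)
  refine (hdC.mul (hdD.fun_inv hD)).congr_of_eventuallyEq ?_
  filter_upwards [hn, hdD.continuousAt.eventually_ne hD] with y hy' hD'
  simp [sdWeyl_eq hS he hy', hD']

end Charts

/-! ### The first integral of the differential equation -/

section FirstIntegral

/-- The derivative of `u³ P² / (P - 4c)⁶`, where `P = q u`, contains the left-hand side of the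
differential equation as a factor. The exponents come from the partial fractions of
`4 (P + 2c) dP / (3 P (P - 4c)) = du / u`, which is the equation in the variables `P` and `u`. -/
theorem hasDerivAt_firstIntegral {q u : ℝ → ℂ} {q' u' c : ℂ} {t : ℝ} (hq : HasDerivAt q q' t)
    (hu : HasDerivAt u u' t) (h4 : q t * u t - 4 * c ≠ 0) (h2 : q t * u t + 2 * c ≠ 0) :
    HasDerivAt (fun s ↦ u s ^ 3 * (q s * u s) ^ 2 / (q s * u s - 4 * c) ^ 6)
      (-4 * u t ^ 3 * (q t * u t) * (q t * u t + 2 * c) / (q t * u t - 4 * c) ^ 7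
        * (u t * q' + (1 / 4) * ((q t * u t + 20 * c) / (q t * u t + 2 * c)) * q t * u')) t := by
  have hp := hq.fun_mul hu
  have h := ((hu.fun_pow 3).fun_mul (hp.fun_pow 2)).fun_div ((hp.sub_const (4 * c)).fun_pow 6)
    (pow_ne_zero 6 h4)
  refine h.congr_deriv ?_
  set A := q t * u t - 4 * c with hA
  set B := q t * u t + 2 * c with hB
  field_simp
  rw [hA, hB]
  push_cast
  ring

variable {M : Type*} [TopologicalSpace M] [ChartedSpace E4 M] [IsManifold 𝓘(ℝ, E4) ∞ M]

/-- The first integral `u³ P² / (P - 4Λ)⁶` with `u = ℱ²` and `P = Q ℱ²`. -/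
noncomputable def firstIntegral (g : LorentzMetric M) (Λ : ℝ) (F : ComplexTwoForm M) (Q : M → ℂ)
    (x : M) : ℂ :=
  formSq g F x ^ 3 * (Q x * formSq g F x) ^ 2 / (Q x * formSq g F x - 4 * Λ) ^ 6

variable {g : LorentzMetric M} {Λ : ℝ} {F : ComplexTwoForm M} {Q : M → ℂ}

/-- The derivative of the first integral along a coordinate line of direction `w`. The point `x` and
the tangent vector `v` are variables tied by equations so that the lemma applies without transport
between tangent spaces. -/
theorem hasDerivAt_firstIntegral_chart (hQ : MDifferentiable 𝓘(ℝ, E4) 𝓘(ℝ, ℂ) Q)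
    (hne : NonvanishingFQ g Λ F Q) {e : OpenPartialHomeomorph M E4} (he : e ∈ atlas E4 M)
    {y : E4} (hy : y ∈ e.target) (w : E4) {x : M} (hx : x = e.symm y)
    {v : TangentSpace 𝓘(ℝ, E4) (e.symm y)} (hv : v = mfderiv 𝓘(ℝ, E4) 𝓘(ℝ, E4) e.symm y w) :
    HasDerivAt (fun t : ℝ ↦ firstIntegral g Λ F Q (e.symm (y + t • w)))
      (-4 * formSq g F x ^ 3 * (Q x * formSq g F x) * (Q x * formSq g F x + 2 * Λ)
        / (Q x * formSq g F x - 4 * Λ) ^ 7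
        * (formSq g F x * (show ℂ from mfderiv 𝓘(ℝ, E4) 𝓘(ℝ, ℂ) Q (e.symm y) v)
          + (1 / 4) * ((Q x * formSq g F x + 20 * Λ) / (Q x * formSq g F x + 2 * Λ)) * Q x
          * (show ℂ from mfderiv 𝓘(ℝ, E4) 𝓘(ℝ, ℂ) (formSq g F) (e.symm y) v))) 0 := by
  subst hx hv
  have hline : HasDerivAt (fun t : ℝ ↦ y + t • w) w 0 := by
    simpa using ((hasDerivAt_id (0 : ℝ)).smul_const w).const_add y
  have hy0 : y = y + (0 : ℝ) • w := by simp
  have hq := (hasFDerivAt_chart he hy (hQ _)).comp_hasDerivAt_of_eq (0 : ℝ) hline hy0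
  have hu := (hasFDerivAt_chart he hy (mdifferentiable_formSq g F _)).comp_hasDerivAt_of_eq
    (0 : ℝ) hline hy0
  have h := hasDerivAt_firstIntegral (c := Λ) hq hu (by simpa using (hne (e.symm y)).2.1)
    (by simpa using (hne (e.symm y)).2.2)
  simp only [Function.comp, zero_smul, add_zero] at h
  exact h

theorem firstIntegral_eq [PreconnectedSpace M] (hpde : SatisfiesPDE g Λ F Q)
    (hne : NonvanishingFQ g Λ F Q) (x x' : M) :
    firstIntegral g Λ F Q x = firstIntegral g Λ F Q x' := by
  refine eq_of_fderiv_chart_eq_zero (fun e he y hy ↦ ?_) x x'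
  have hq := (hasFDerivAt_chart he hy (hpde.1 _)).differentiableAt
  have hu := (hasFDerivAt_chart he hy (mdifferentiable_formSq g F _)).differentiableAt
  have hd : DifferentiableAt ℝ (firstIntegral g Λ F Q ∘ e.symm) y :=
    ((hu.pow 3).mul ((hq.mul hu).pow 2)).mul
      ((((hq.mul hu).sub_const (4 * (Λ : ℂ))).pow 6).fun_inv (pow_ne_zero 6 (hne (e.symm y)).2.1))
  have hz : fderiv ℝ (firstIntegral g Λ F Q ∘ e.symm) y = 0 := by
    ext w
    have hline : HasDerivAt (fun t : ℝ ↦ y + t • w) w 0 := by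
      simpa using ((hasDerivAt_id (0 : ℝ)).smul_const w).const_add y
    have h1 := hd.hasFDerivAt.comp_hasDerivAt_of_eq (0 : ℝ) hline (by simp)
    have h2 := hasDerivAt_firstIntegral_chart hpde.1 hne he hy w rfl rfl
    rw [hpde.2 (e.symm y), mul_zero] at h2
    exact h1.unique h2
  rw [← hz]
  exact hd.hasFDerivAt

theorem satisfiesPDE_of_firstIntegral (hQ : MDifferentiable 𝓘(ℝ, E4) 𝓘(ℝ, ℂ) Q)
    (hne : NonvanishingFQ g Λ F Q) (hQ0 : ∀ x, Q x ≠ 0) {K : ℂ}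
    (hK : ∀ x, firstIntegral g Λ F Q x = K) : SatisfiesPDE g Λ F Q := by
  refine ⟨hQ, fun x ↦ ?_⟩
  have he := chart_mem_atlas E4 x
  have hy := mem_chart_target E4 x
  have hx : (chartAt E4 x).symm (chartAt E4 x x) = x :=
    (chartAt E4 x).left_inv (mem_chart_source E4 x)
  -- The tangent spaces at `x` and at `e.symm (e x)` are different types; the statement is
  -- generalized over the point before it is replaced.
  suffices H : ∀ x', x' = (chartAt E4 x).symm (chartAt E4 x x) →
      ∀ v : TangentSpace 𝓘(ℝ, E4) x',
      formSq g F x' * (show ℂ from mfderiv 𝓘(ℝ, E4) 𝓘(ℝ, ℂ) Q x' v)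
        + (1 / 4) * ((Q x' * formSq g F x' + 20 * Λ) / (Q x' * formSq g F x' + 2 * Λ)) * Q x'
          * (show ℂ from mfderiv 𝓘(ℝ, E4) 𝓘(ℝ, ℂ) (formSq g F) x' v) = 0 from H x hx.symm
  rintro _ rfl v
  obtain ⟨w, hw⟩ := mfderiv_symm_surjective he hy v
  have h := hasDerivAt_firstIntegral_chart hQ hne he hy w rfl hw.symm
  simp only [hK] at h
  have h0 := h.unique (hasDerivAt_const _ _)
  obtain ⟨hn1, hn2, hn3⟩ := hne ((chartAt E4 x).symm (chartAt E4 x x))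
  refine (mul_eq_zero.mp h0).resolve_left ?_
  exact div_ne_zero (mul_ne_zero (mul_ne_zero (mul_ne_zero (by norm_num) (pow_ne_zero 3 hn1))
    (mul_ne_zero (hQ0 _) hn1)) hn3) (pow_ne_zero 7 hn2)

end FirstIntegral

/-! ### Choices of roots and the three conditions -/

section Roots

theorem sqrt_three_halves_sq : ((√(3 / 2) : ℝ) : ℂ) ^ 2 = 3 / 2 := by
  rw [← Complex.ofReal_pow, Real.sq_sqrt (by norm_num)]
  norm_num

theorem sqrt_three_halves_ne_zero : ((√(3 / 2) : ℝ) : ℂ) ≠ 0 := by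
  rw [Complex.ofReal_ne_zero]
  positivity

theorem sqrt_three_halves_mul_sqrt_thirtytwo_thirds :
    ((√(3 / 2) : ℝ) : ℂ) * (√(32 / 3) : ℝ) = 4 := by
  rw [← Complex.ofReal_mul, ← Real.sqrt_mul (by norm_num),
    show (3 / 2 * (32 / 3) : ℝ) = 4 ^ 2 by norm_num, Real.sqrt_sq (by norm_num)]
  norm_num

theorem sqrt_three_halves_mul_sqrt_eight_thirds :
    ((√(3 / 2) : ℝ) : ℂ) * (√(8 / 3) : ℝ) = 2 := by
  rw [← Complex.ofReal_mul, ← Real.sqrt_mul (by norm_num),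
    show (3 / 2 * (8 / 3) : ℝ) = 2 ^ 2 by norm_num, Real.sqrt_sq (by norm_num)]
  norm_num

theorem two_thirds_rpow_ne_zero : (((3 / 2 : ℝ) ^ (2 / 3 : ℝ) : ℝ) : ℂ) ≠ 0 := by
  rw [Complex.ofReal_ne_zero]
  positivity

variable {M : Type*} [TopologicalSpace M] [ChartedSpace E4 M] [IsManifold 𝓘(ℝ, E4) ∞ M]
  {g : LorentzMetric M} {ε : VolumeForm g} {Λ : ℝ} {F : ComplexTwoForm M} {Q ρ : M → ℂ} {σ : ℂ}

/-- `Q ℱ² = ±√(3/2) √𝒞²` everywhere: both sides are continuous with equal squares, the right-hand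
side has no zero, and they agree at one point. -/
theorem mul_formSq_eq_root [PreconnectedSpace M] (hF : IsSelfDual ε F) (hS : MSTVanishes ε F Q)
    (hρ : IsRootChoice ε F Q ρ σ) (hC : ∀ x, weylSq ε x ≠ 0) (x : M) :
    Q x * formSq g F x = (√(3 / 2) : ℝ) * (σ * ρ x ^ 3) := by
  obtain ⟨hcont, hpow, hσ, x₀, hx₀⟩ := hρ
  have hσ2 : σ ^ 2 = 1 := by rcases hσ with rfl | rfl <;> norm_num
  have hσ0 : σ ≠ 0 := by rintro rfl; norm_num at hσ2
  have hQc : Continuous Q := continuous_iff_continuousAt.mpr fun x ↦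
    (mdifferentiableAt_of_weylSq_ne_zero hS (hC x)).continuousAt
  have huc : Continuous (formSq g F) := (mdifferentiable_formSq g F).continuous
  refine isPreconnected_univ.eq_of_sq_eq (f := fun x ↦ Q x * formSq g F x)
    (g := fun x ↦ (√(3 / 2) : ℝ) * (σ * ρ x ^ 3)) (by fun_prop) (by fun_prop) ?_ ?_
    (Set.mem_univ x₀) ?_ (Set.mem_univ x)
  · intro z _
    have h1 := weylSq_eq hF hS z
    rw [← hpow] at h1
    simp only [Pi.pow_apply, mul_pow, sqrt_three_halves_sq, hσ2]
    linear_combination (-3 / 2 : ℂ) * h1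
  · intro z _
    have : ρ z ≠ 0 := fun h ↦ hC z (by rw [← hpow, h]; norm_num)
    exact mul_ne_zero sqrt_three_halves_ne_zero (mul_ne_zero hσ0 (pow_ne_zero 3 this))
  · simp only [hx₀]
    ring

theorem sub_eq_root {p z : ℂ} (h : p = (√(3 / 2) : ℝ) * z) :
    p - 4 * Λ = (√(3 / 2) : ℝ) * (z - (√(32 / 3) : ℝ) * Λ) := by
  rw [h, ← sqrt_three_halves_mul_sqrt_thirtytwo_thirds]; ring

theorem add_eq_root {p z : ℂ} (h : p = (√(3 / 2) : ℝ) * z) :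
    p + 2 * Λ = (√(3 / 2) : ℝ) * (z + (√(8 / 3) : ℝ) * Λ) := by
  rw [h, ← sqrt_three_halves_mul_sqrt_eight_thirds]; ring

theorem relatesCF_iff_isQC [PreconnectedSpace M] (hF : IsSelfDual ε F) (hS : MSTVanishes ε F Q)
    (hρ : IsRootChoice ε F Q ρ σ) (hC : NonvanishingC ε Λ ρ σ) :
    RelatesCF g Λ F ρ σ ↔ IsQC Λ Q ρ σ := by
  have hP := mul_formSq_eq_root hF hS hρ fun x ↦ (hC x).1
  obtain ⟨-, hpow, hσ, -⟩ := hρ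
  have hσ0 : σ ≠ 0 := by rcases hσ with rfl | rfl <;> norm_num
  have hρ0 : ∀ x, ρ x ≠ 0 := fun x h ↦ (hC x).1 (by rw [← hpow, h]; norm_num)
  have hr := sqrt_three_halves_ne_zero
  have hb := two_thirds_rpow_ne_zero
  set r : ℂ := ((√(3 / 2) : ℝ) : ℂ) with hr_def
  set b : ℂ := (((3 / 2 : ℝ) ^ (2 / 3 : ℝ) : ℝ) : ℂ) with hb_def
  constructor
  · rintro ⟨k, hk, h⟩
    refine ⟨r * σ / (k * b), by positivity, fun x ↦ ?_⟩
    have hz := (hC x).2.1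
    have hx := hP x
    have hρx := hρ0 x
    rw [h x] at hx
    rw [← hb_def] at hx
    set z := σ * ρ x ^ 3 - ((√(32 / 3) : ℝ) : ℂ) * Λ
    field_simp at hx ⊢
    linear_combination hx
  · rintro ⟨k, hk, h⟩
    refine ⟨r * σ / (k * b), by positivity, fun x ↦ ?_⟩
    have hz := (hC x).2.1
    have hx := hP x
    have hρx := hρ0 x
    rw [h x] at hx
    rw [← hb_def]
    set z := σ * ρ x ^ 3 - ((√(32 / 3) : ℝ) : ℂ) * Λ
    field_simp at hx ⊢
    linear_combination hx

theorem pde_of_relatesCF [PreconnectedSpace M] (hF : IsSelfDual ε F) (hS : MSTVanishes ε F Q)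
    (hρ : IsRootChoice ε F Q ρ σ) (hC : NonvanishingC ε Λ ρ σ) (hrel : RelatesCF g Λ F ρ σ) :
    SatisfiesPDE g Λ F Q ∧ NonvanishingFQ g Λ F Q := by
  have hP := mul_formSq_eq_root hF hS hρ fun x ↦ (hC x).1
  have hQ : MDifferentiable 𝓘(ℝ, E4) 𝓘(ℝ, ℂ) Q := fun x ↦
    mdifferentiableAt_of_weylSq_ne_zero hS (hC x).1
  have hr := sqrt_three_halves_ne_zero
  have hne0 : ∀ x, Q x * formSq g F x ≠ 0 := fun x h ↦ (hC x).1 (by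
    rw [weylSq_eq hF hS, h]; norm_num)
  have hne : NonvanishingFQ g Λ F Q := fun x ↦ by
    refine ⟨right_ne_zero_of_mul (hne0 x), ?_, ?_⟩
    · rw [sub_eq_root (hP x)]
      exact mul_ne_zero hr (hC x).2.1
    · rw [add_eq_root (hP x)]
      exact mul_ne_zero hr (hC x).2.2
  refine ⟨?_, hne⟩
  obtain ⟨-, hpow, hσ, -⟩ := hρ
  have hσ2 : σ ^ 2 = 1 := by rcases hσ with rfl | rfl <;> norm_num
  obtain ⟨k, hk, h⟩ := hrel
  refine satisfiesPDE_of_firstIntegral hQ hne (fun x ↦ left_ne_zero_of_mul (hne0 x))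
    (K := (k * ((3 / 2 : ℝ) ^ (2 / 3 : ℝ) : ℝ)) ^ 3 / ((√(3 / 2) : ℝ) : ℂ) ^ 4) fun x ↦ ?_
  have hρ0 : ρ x ≠ 0 := fun h ↦ (hC x).1 (by rw [← hpow, h]; norm_num)
  have hz := (hC x).2.1
  rw [firstIntegral, sub_eq_root (hP x), hP x, h x]
  set z := σ * ρ x ^ 3 - ((√(32 / 3) : ℝ) : ℂ) * Λ
  field_simp
  rw [hσ2]

theorem exists_root_of_pde [ConnectedSpace M] (hflat : Λ ≠ 0 → ¬ IsConformallyFlat g)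
    (hF : IsSelfDual ε F) (hS : MSTVanishes ε F Q) (hpde : SatisfiesPDE g Λ F Q)
    (hne : NonvanishingFQ g Λ F Q) :
    ∃ (ρ : M → ℂ) (σ : ℂ), IsRootChoice ε F Q ρ σ ∧ RelatesCF g Λ F ρ σ ∧
      NonvanishingC ε Λ ρ σ := by
  obtain ⟨x₀⟩ : Nonempty M := inferInstance
  have hr := sqrt_three_halves_ne_zero
  have hr2 := sqrt_three_halves_sq
  have hb := two_thirds_rpow_ne_zero
  set K := firstIntegral g Λ F Q x₀ with hKdef
  have hK : ∀ x, firstIntegral g Λ F Q x = K := fun x ↦ firstIntegral_eq hpde hne x x₀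
  have hK0 : K ≠ 0 := by
    intro h0
    have hQ0 : ∀ x, Q x = 0 := fun x ↦ by
      have h := hK x
      obtain ⟨h1, h2, -⟩ := hne x
      simpa [firstIntegral, h0, h1, h2] using h
    by_cases hΛ : Λ = 0
    · exact (hne x₀).2.1 (by simp [hΛ, hQ0])
    · exact hflat hΛ (isConformallyFlat_of_eq_zero hS hQ0)
  have hP0 : ∀ x, Q x * formSq g F x ≠ 0 := fun x h ↦ hK0 (by
    rw [← hK x, firstIntegral, h]; simp)
  set r : ℂ := ((√(3 / 2) : ℝ) : ℂ) with hr_def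
  -- `m³ = 1 / (r K)` makes `ρ³ = P / r`, because `(P u)³ = P K (P - 4Λ)⁶`.
  obtain ⟨m, hm⟩ := IsAlgClosed.exists_pow_nat_eq (1 / (r * K)) (n := 3) (by norm_num)
  have hm0 : m ≠ 0 := by
    rintro rfl
    exact one_div_ne_zero (mul_ne_zero hr hK0) (by rw [← hm]; norm_num)
  set ρ : M → ℂ := fun x ↦
    m * (Q x * formSq g F x * formSq g F x) / (Q x * formSq g F x - 4 * Λ) ^ 2 with hρdef
  have hP : ∀ x, Q x * formSq g F x = r * (1 * ρ x ^ 3) := fun x ↦ by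
    have h := hK x
    obtain ⟨h1, h2, -⟩ := hne x
    rw [firstIntegral, div_eq_iff (pow_ne_zero 6 h2)] at h
    simp only [hρdef, div_pow, mul_pow, hm] at h ⊢
    field_simp
    linear_combination (-Q x) * h
  refine ⟨ρ, 1, ⟨?_, fun x ↦ ?_, Or.inl rfl, x₀, by rw [hP]; ring⟩, ?_, fun x ↦ ⟨?_, ?_, ?_⟩⟩
  · have hQc : Continuous Q := hpde.1.continuous
    have huc : Continuous (formSq g F) := (mdifferentiable_formSq g F).continuous
    exact Continuous.div (by fun_prop) (by fun_prop) fun x ↦ pow_ne_zero 2 (hne x).2.1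
  · rw [weylSq_eq hF hS, hP x, mul_pow, hr2]
    ring
  · refine ⟨K * m ^ 2 * r ^ 2 / (((3 / 2 : ℝ) ^ (2 / 3 : ℝ) : ℝ) : ℂ), by positivity, fun x ↦ ?_⟩
    have h := hK x
    obtain ⟨h1, h2, -⟩ := hne x
    have h3 := hP0 x
    have h4 := sub_eq_root (Λ := Λ) (hP x)
    have h5 : (1 * ρ x ^ 3 - ((√(32 / 3) : ℝ) : ℂ) * Λ)
        = (Q x * formSq g F x - 4 * Λ) / r := by
      rw [h4, ← hr_def, mul_div_cancel_left₀ _ hr]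
    rw [firstIntegral, div_eq_iff (pow_ne_zero 6 h2)] at h
    rw [h5]
    simp only [hρdef]
    have hQ0 := left_ne_zero_of_mul h3
    set p := Q x * formSq g F x - 4 * (Λ : ℂ)
    field_simp
    linear_combination h
  · rw [weylSq_eq hF hS]
    exact mul_ne_zero (by norm_num) (pow_ne_zero 2 (hP0 x))
  · exact right_ne_zero_of_mul (sub_eq_root (Λ := Λ) (hP x) ▸ (hne x).2.1)
  · exact right_ne_zero_of_mul (add_eq_root (Λ := Λ) (hP x) ▸ (hne x).2.2)

end Roots

end MarsSimon

theorem lemma4p1 {M : Type*} [TopologicalSpace M] [ChartedSpace MarsSimon.E4 M]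
    [IsManifold 𝓘(ℝ, MarsSimon.E4) ∞ M] [ConnectedSpace M]
    (g : MarsSimon.LorentzMetric M) (ε : MarsSimon.VolumeForm g) (Λ : ℝ)
    (hvac : MarsSimon.IsLambdaVacuum g Λ)
    (hflat : Λ ≠ 0 → ¬ MarsSimon.IsConformallyFlat g)
    (F : MarsSimon.ComplexTwoForm M) (hF : MarsSimon.IsSelfDual ε F)
    (Q : M → ℂ) (hS : MarsSimon.MSTVanishes ε F Q) :
    List.TFAE [
      MarsSimon.SatisfiesPDE g Λ F Q ∧ MarsSimon.NonvanishingFQ g Λ F Q,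
      ∃ (ρ : M → ℂ) (σ : ℂ), MarsSimon.IsRootChoice ε F Q ρ σ ∧
        MarsSimon.RelatesCF g Λ F ρ σ ∧ MarsSimon.NonvanishingC ε Λ ρ σ,
      ∃ (ρ : M → ℂ) (σ : ℂ), MarsSimon.IsRootChoice ε F Q ρ σ ∧
        MarsSimon.IsQC Λ Q ρ σ ∧ MarsSimon.NonvanishingC ε Λ ρ σ] := by
  tfae_have 1 → 2 := fun h ↦ MarsSimon.exists_root_of_pde hflat hF hS h.1 h.2
  tfae_have 2 → 1 := fun ⟨_, _, hρ, hrel, hC⟩ ↦ MarsSimon.pde_of_relatesCF hF hS hρ hC hrel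
  tfae_have 2 ↔ 3 := exists_congr fun _ ↦ exists_congr fun _ ↦ and_congr_right fun hρ ↦
    and_congr_left fun hC ↦ MarsSimon.relatesCF_iff_isQC hF hS hρ hC
  tfae_finish
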